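/- All triangulated categories are essentially small and all subcategories are full. For a triangulated category $\mathcal T$, a thick subcategory is a subcategory containing $0$ and closed under shifts, extensions and direct summands; $\langle M\rangle$ denotes the smallest thick subcategory containing the object $M$. A thick subcategory $\mathcal P\subsetneq\mathcal T$ is prime if the set of thick subcategories strictly containing $\mathcal P$ has a smallest element. $\mathrm{Spec}_\triangle(\mathcal T)$ is the set of prime thick subcategories with the topology whose closed sets are the sets $\{\mathcal P\mid \mathcal P\cap\mathcal E=\emptyset\}$ for sets of objects $\mathcal E$ of $\mathcal T$. The center $\mathrm Z(\mathcal T)$ is the commutative ring of natural transformations $\eta:\mathrm{id}_{\mathcal T}\to\mathrm{id}_{\mathcal T}$ with $\eta[1]=[1]\eta$, and $\mathrm Z(\mathcal T)_{\mathrm{lred}}$ is its quotient by the ideal of those $\eta$ for which every $\eta_M$ is nilpotent. For an open subset $U$ put $\mathcal T^U=\bigcap_{\mathcal P\in U}\mathcal P$ and $\mathcal T(U)=(\mathcal T/\mathcal T^U)^\natural$, the idempotent completion of the Verdier quotient. $\mathrm{Spec}_\triangle(\mathcal T)$ is a ringed space with structure sheaf the sheafification of the presheaf $U\mapsto \mathrm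 Z(\mathcal T(U))_{\mathrm{lred}}$, whose restriction maps are induced by the canonical functors $\mathcal T(V)\to\mathcal T(U)$ for $U\subseteq V$. An exact functor $\Phi:\mathcal T\to\mathcal T'$ is said to induce a morphism of ringed spaces $f:\mathrm{Spec}_\triangle(\mathcal T')\to\mathrm{Spec}_\triangle(\mathcal T)$ if $f(\mathcal P)=\Phi^{-1}(\mathcal P)$ for all $\mathcal P$ and if, for every open $V\subseteq\mathrm{Spec}_\triangle(\mathcal T)$ and $\eta\in\mathrm Z(\mathcal T(V))$, the section given by $\eta$ is sent to the section given by some $\theta\in\mathrm Z(\mathcal T'(f^{-1}V))$ such that $\theta_{\Phi_V(N)}=\Phi_V(\eta_N)$ for all $N\in\mathcal T(V)$, where $\Phi_V:\mathcal T(V)\to\mathcal T'(f^{-1}V)$ is the functor induced by $\Phi$. Let $\mathcal T$ be a triangulated category. 1. For every thick subcategory $\mathcal K$ of $\mathcal T$, the quotient functor $\mathcal T\to\mathcal T/\mathcal K$ induces a unique morphism of ringed spaces $\mathrm{Spec}_\triangle(\mathcal T/\mathcal K)\to\mathrm{Spec}_\triangle(\mathcal T)$. 2. If the image of this morphism is an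 open subset of $\mathrm{Spec}_\triangle(\mathcal T)$, then the morphism is an open immersion of ringed spaces. 3. If $\mathcal K=\langle M\rangle$ for an object $M\in\mathcal T$, then the image is open, so the morphism is an open immersion of ringed spaces. 4. Let $\Phi:\mathcal T\to\mathcal T'$ be a fully faithful exact functor of triangulated categories which is dense, i.e. for every $M'\in\mathcal T'$ there are $M\in\mathcal T$ and $N'\in\mathcal T'$ with $\Phi(M)\cong M'\oplus N'$. Then $\Phi$ induces a unique morphism of ringed spaces $\mathrm{Spec}_\triangle(\mathcal T')\to\mathrm{Spec}_\triangle(\mathcal T)$, and this morphism is an isomorphism of ringed spaces. -/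

import Mathlib

open CategoryTheory Limits Pretriangulated TopologicalSpace Opposite
open CategoryTheory.Idempotents ZeroObject

universe v₁ v₂ v₃ v u₁ u₂ u₃ u

noncomputable section

namespace TriangularSpectrum

/-! ### The shift on the idempotent completion -/

section KaroubiShift

variable {C : Type u} [Category.{v} C]

/-- The shift on the idempotent completion: `(X, p)⟦n⟧ = (X⟦n⟧, p⟦n⟧)`. This is the shift of the
triangulated structure; the center depends on the triangulated structure only through it. -/
instance karoubiHasShift [HasShift C ℤ] : HasShift (Karoubi C) ℤ :=
  HasShift.induced (toKaroubi C) ℤ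
    (fun n => (functorExtension₂ C C).obj (shiftFunctor C n))
    (fun n => (functorExtension₂CompWhiskeringLeftToKaroubiIso C C).app (shiftFunctor C n))

lemma karoubi_shift_obj [HasShift C ℤ] (P : Karoubi C) (n : ℤ) :
    P⟦n⟧ = ⟨P.X⟦n⟧, P.p⟦n⟧', by rw [← Functor.map_comp, P.idem]⟩ := rfl

lemma karoubi_shift_map_f [HasShift C ℤ] {P Q : Karoubi C} (f : P ⟶ Q) (n : ℤ) :
    (f⟦n⟧').f = f.f⟦n⟧' := rfl

instance karoubiShiftAdditive [Preadditive C] [HasShift C ℤ]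
    [∀ n : ℤ, (shiftFunctor C n).Additive] (n : ℤ) :
    (shiftFunctor (Karoubi C) n).Additive where
  map_add {P Q f g} := by
    ext
    change (f.f + g.f)⟦n⟧' = f.f⟦n⟧' + g.f⟦n⟧'
    exact Functor.map_add _

end KaroubiShift

/-! ### The center -/

section Center

variable (C : Type u) [Category.{v} C] [Preadditive C] [HasShift C ℤ]
  [∀ n : ℤ, (shiftFunctor C n).Additive]

/-- The center: natural endomorphisms `η` of the identity functor with
`η (X⟦1⟧) = (η X)⟦1⟧` for all `X`. -/
def centerSubring : Subring (CatCenter C) where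
  carrier := {η | ∀ X : C, η.app (X⟦(1 : ℤ)⟧) = (η.app X)⟦(1 : ℤ)⟧'}
  mul_mem' {a b} ha hb X := by
    rw [CatCenter.mul_app, CatCenter.mul_app, ha, hb, Functor.map_comp]
  one_mem' X := ((shiftFunctor C (1 : ℤ)).map_id X).symm
  add_mem' {a b} ha hb X := by
    rw [CatCenter.app_add, CatCenter.app_add, ha, hb, Functor.map_add]
  zero_mem' X := ((shiftFunctor C (1 : ℤ)).map_zero X X).symm
  neg_mem' {a} ha X := by
    rw [CatCenter.app_neg, CatCenter.app_neg, ha, Functor.map_neg]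

/-- The center `Z(C)` as a commutative ring. -/
abbrev Center : Type _ := centerSubring C

instance centerCommRing : CommRing (Center C) :=
  { (inferInstance : Ring (Center C)) with
    mul_comm := fun a b => Subtype.ext (mul_comm' a.1 b.1) }

variable {C} in
/-- The component of a central element at an object, in the endomorphism ring. -/
def Center.endo (η : Center C) (X : C) : End X := η.1.app X

variable {C} in
lemma Center.endo_pow (η : Center C) (X : C) (n : ℕ) : (η ^ n).endo X = η.endo X ^ n := by
  induction n with
  | zero => rfl
  | succ n ih => rw [pow_succ, pow_succ, ← ih]; rfl

/-- The ideal of locally nilpotent elements of the center. -/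
def lnil : Ideal (Center C) where
  carrier := {η | ∀ X : C, IsNilpotent (η.endo X)}
  add_mem' {a b} ha hb X := by
    have h : Commute (a.endo X) (b.endo X) := congrArg (fun z : Center C => z.endo X) (mul_comm a b)
    exact h.isNilpotent_add (ha X) (hb X)
  zero_mem' X := IsNilpotent.zero
  smul_mem' c x hx X := by
    have h : Commute (c.endo X) (x.endo X) := congrArg (fun z : Center C => z.endo X) (mul_comm c x)
    exact h.isNilpotent_mul_left (hx X)

/-- `Z(C)_lred`, the center modulo the locally nilpotent elements. -/
abbrev CenterLred : Type _ := Center C ⧸ lnil C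

end Center

section CenterMaps

variable {C : Type u₁} [Category.{v₁} C] [Preadditive C] [HasShift C ℤ]
  [∀ n : ℤ, (shiftFunctor C n).Additive]
  {D : Type u₂} [Category.{v₂} D] [Preadditive D] [HasShift D ℤ]
  [∀ n : ℤ, (shiftFunctor D n).Additive]
  {E : Type u₃} [Category.{v₃} E] [Preadditive E] [HasShift E ℤ]
  [∀ n : ℤ, (shiftFunctor E n).Additive]

/-- `η` and `θ` correspond to each other under `F`: `θ (F X) = F (η X)` for all `X`. -/
def CenterCompatible (F : C ⥤ D) (η : Center C) (θ : Center D) : Prop :=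
  ∀ X : C, θ.1.app (F.obj X) = F.map (η.1.app X)

lemma CenterCompatible.comp {F : C ⥤ D} {G : D ⥤ E} {η : Center C} {θ : Center D} {κ : Center E}
    (h : CenterCompatible F η θ) (h' : CenterCompatible G θ κ) :
    CenterCompatible (F ⋙ G) η κ := fun X => by
  have := h' (F.obj X)
  rw [h X] at this
  exact this

lemma CenterCompatible.of_iso {F F' : C ⥤ D} (e : F ≅ F') {η : Center C} {θ : Center D}
    (h : CenterCompatible F η θ) : CenterCompatible F' η θ := fun X => by
  have h₁ := CatCenter.naturality θ.1 (e.inv.app X)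
  rw [h X, ← e.inv.naturality] at h₁
  exact (cancel_mono (e.inv.app X)).1 h₁.symm

lemma CenterCompatible.unique {F : C ⥤ D} [F.EssSurj] {η : Center C} {θ θ' : Center D}
    (h : CenterCompatible F η θ) (h' : CenterCompatible F η θ') : θ = θ' := by
  apply Subtype.ext
  apply CatCenter.ext
  intro Y
  rw [← cancel_epi (F.objObjPreimageIso Y).hom, CatCenter.naturality, CatCenter.naturality,
    h, h']

lemma CenterCompatible.refl (η : Center C) : CenterCompatible (𝟭 C) η η := fun _ => rfl

/-- A ring homomorphism between centers which is compatible with an essentially surjective functor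
preserves locally nilpotent elements. -/
lemma lnil_le_comap (F : C ⥤ D) [F.EssSurj] [F.Additive] (φ : Center C →+* Center D)
    (h : ∀ η, CenterCompatible F η (φ η)) : lnil C ≤ (lnil D).comap φ := by
  intro η hη Y
  obtain ⟨n, hn⟩ := hη (F.objPreimage Y)
  refine ⟨n, ?_⟩
  rw [← Center.endo_pow] at hn ⊢
  rw [← map_pow]
  have h₁ := h (η ^ n) (F.objPreimage Y)
  have h₂ : (η ^ n).1.app (F.objPreimage Y) = 0 := hn
  rw [h₂, F.map_zero] at h₁
  change (φ (η ^ n)).1.app Y = 0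
  rw [← cancel_epi (F.objObjPreimageIso Y).hom, CatCenter.naturality, h₁, zero_comp, comp_zero]

/-- The map on centers induced by a localization functor. -/
def centerLocalization (F : C ⥤ D) (W : MorphismProperty C) [F.IsLocalization W] [F.Additive]
    [F.CommShift ℤ] : Center C →+* Center D :=
  ((CatCenter.localizationRingHom F W).comp (centerSubring C).subtype).codRestrict _ (by
    intro η Y
    have := Localization.essSurj F W
    have key : ∀ X : C, (η.1.localization F W).app ((F.obj X)⟦(1 : ℤ)⟧) =
        ((η.1.localization F W).app (F.obj X))⟦(1 : ℤ)⟧' := fun X => by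
      have h₁ := CatCenter.naturality (η.1.localization F W) ((F.commShiftIso (1 : ℤ)).inv.app X)
      have h₂ := (F.commShiftIso (1 : ℤ)).inv.naturality (η.1.app X)
      dsimp at h₁ h₂
      rw [CatCenter.localization_app, η.2 X, ← h₂] at h₁
      rw [CatCenter.localization_app]
      exact (cancel_mono ((F.commShiftIso (1 : ℤ)).inv.app X)).1 h₁.symm
    let e := F.objObjPreimageIso Y
    change (η.1.localization F W).app (Y⟦(1 : ℤ)⟧) = ((η.1.localization F W).app Y)⟦(1 : ℤ)⟧'
    rw [← cancel_epi (e.hom⟦(1 : ℤ)⟧'), CatCenter.naturality, key, ← Functor.map_comp,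
      ← Functor.map_comp, CatCenter.naturality])

lemma centerLocalization_compatible (F : C ⥤ D) (W : MorphismProperty C) [F.IsLocalization W]
    [F.Additive] [F.CommShift ℤ] (η : Center C) :
    CenterCompatible F η (centerLocalization F W η) := fun X =>
  CatCenter.localization_app _ F W X

/-- A category and its idempotent completion have the same center. -/
def karoubiCenterEquiv : Center C ≃+* Center (Karoubi C) where
  toFun η := ⟨{ app := fun P => ⟨P.p ≫ η.1.app P.X, by
                  rw [Category.assoc, ← CatCenter.naturality]; simp⟩
                naturality := fun P Q f => by
                  ext
                  change f.f ≫ Q.p ≫ η.1.app Q.X = (P.p ≫ η.1.app P.X) ≫ f.f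
                  rw [Category.assoc, ← CatCenter.naturality]
                  simp }, fun P => by
      ext
      change P.p⟦(1 : ℤ)⟧' ≫ η.1.app (P.X⟦(1 : ℤ)⟧) = (P.p ≫ η.1.app P.X)⟦(1 : ℤ)⟧'
      rw [η.2, Functor.map_comp]⟩
  invFun θ := ⟨{ app := fun X => (θ.1.app ((toKaroubi C).obj X)).f
                 naturality := fun X Y f =>
                  congrArg Karoubi.Hom.f (θ.1.naturality ((toKaroubi C).map f)) }, fun X => by
      have h := congrArg Karoubi.Hom.f (CatCenter.naturality θ.1
        (⟨𝟙 _, by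
          change 𝟙 _ ≫ 𝟙 _ ≫ (𝟙 X)⟦(1 : ℤ)⟧' = 𝟙 _
          simp⟩ : (toKaroubi C).obj (X⟦(1 : ℤ)⟧) ⟶ ((toKaroubi C).obj X)⟦(1 : ℤ)⟧))
      rw [θ.2] at h
      change 𝟙 _ ≫ (θ.1.app ((toKaroubi C).obj X)).f⟦(1 : ℤ)⟧' =
        (θ.1.app ((toKaroubi C).obj (X⟦(1 : ℤ)⟧))).f ≫ 𝟙 _ at h
      rw [Category.id_comp, Category.comp_id] at h
      exact h.symm⟩
  left_inv η := by
    apply Subtype.ext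
    apply CatCenter.ext
    intro X
    exact Category.id_comp _
  right_inv θ := by
    apply Subtype.ext
    apply CatCenter.ext
    intro P
    ext
    change P.p ≫ (θ.1.app ((toKaroubi C).obj P.X)).f = (θ.1.app P).f
    have h := congrArg Karoubi.Hom.f (CatCenter.naturality θ.1
      (⟨P.p, by simp⟩ : P ⟶ (toKaroubi C).obj P.X))
    change P.p ≫ (θ.1.app ((toKaroubi C).obj P.X)).f = (θ.1.app P).f ≫ P.p at h
    rw [h]
    simp
  map_mul' a b := by
    apply Subtype.ext
    apply CatCenter.ext
    intro P
    ext
    change P.p ≫ b.1.app P.X ≫ a.1.app P.X = (P.p ≫ b.1.app P.X) ≫ P.p ≫ a.1.app P.X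
    rw [Category.assoc, ← CatCenter.naturality_assoc, P.idem_assoc]
  map_add' a b := by
    apply Subtype.ext
    apply CatCenter.ext
    intro P
    ext
    exact Preadditive.comp_add _ _ _ _ _ _

/-- The functor between idempotent completions induced by a functor. -/
abbrev karoubiMap (F : C ⥤ D) : Karoubi C ⥤ Karoubi D := (functorExtension₂ C D).obj F

lemma karoubiCenterEquiv_compatible {F : C ⥤ D} {η : Center C} {θ : Center D}
    (h : CenterCompatible F η θ) :
    CenterCompatible (karoubiMap F) (karoubiCenterEquiv η) (karoubiCenterEquiv θ) := fun P => by
  ext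
  change F.map P.p ≫ θ.1.app (F.obj P.X) = F.map (P.p ≫ η.1.app P.X)
  rw [h, F.map_comp]

lemma karoubiCenterEquiv_lnil (η : Center C) :
    karoubiCenterEquiv η ∈ lnil (Karoubi C) ↔ η ∈ lnil C := by
  constructor
  · intro h X
    obtain ⟨n, hn⟩ := h ((toKaroubi C).obj X)
    refine ⟨n, ?_⟩
    rw [← Center.endo_pow] at hn ⊢
    rw [← map_pow] at hn
    have h₁ : 𝟙 X ≫ (η ^ n).1.app X = 0 := congrArg Karoubi.Hom.f hn
    rw [Category.id_comp] at h₁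
    exact h₁
  · intro h P
    obtain ⟨n, hn⟩ := h P.X
    refine ⟨n, ?_⟩
    rw [← Center.endo_pow] at hn ⊢
    rw [← map_pow]
    have h₂ : (η ^ n).1.app P.X = 0 := hn
    change (karoubiCenterEquiv (η ^ n)).1.app P = 0
    ext
    change P.p ≫ (η ^ n).1.app P.X = 0
    rw [h₂, comp_zero]

end CenterMaps

/-! ### Thick subcategories -/

section Thick

variable (T : Type u) [Category.{v} T] [Preadditive T] [HasZeroObject T] [HasShift T ℤ]
  [∀ n : ℤ, (shiftFunctor T n).Additive] [Pretriangulated T]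

/-- A thick subcategory: a full triangulated subcategory closed under direct summands. -/
@[ext]
structure ThickSubcategory where
  /-- the objects of the subcategory -/
  carrier : ObjectProperty T
  isTriangulated : carrier.IsTriangulated
  isStableUnderRetracts : carrier.IsStableUnderRetracts

attribute [instance] ThickSubcategory.isTriangulated ThickSubcategory.isStableUnderRetracts

namespace ThickSubcategory

variable {T}

instance : PartialOrder (ThickSubcategory T) :=
  PartialOrder.lift carrier fun _ _ h => ThickSubcategory.ext h

/-- The intersection of a family of thick subcategories. -/
instance : InfSet (ThickSubcategory T) where
  sInf S :=
    { carrier := fun X => ∀ K ∈ S, K.carrier X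
      isStableUnderRetracts :=
        { of_retract := fun r h K hK => K.carrier.prop_of_retract r (h K hK) }
      isTriangulated :=
        { exists_zero := ⟨0, isZero_zero T, fun K _ => K.carrier.prop_zero⟩
          isStableUnderShiftBy := fun n =>
            { le_shift := fun X h K hK => K.carrier.le_shift n X (h K hK) }
          ext₂' := fun D hD h₁ h₃ => ObjectProperty.le_isoClosure _ _ fun K hK =>
            K.carrier.ext_of_isTriangulatedClosed₂ D hD (h₁ K hK) (h₃ K hK) } }

/-- `⟨M⟩`, the smallest thick subcategory containing `M`. -/
def generatedBy (M : T) : ThickSubcategory T := sInf {K | K.carrier M}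

/-- The closed subset `Z(ℰ)` of the set of thick subcategories. -/
def zeroLocus (ℰ : Set T) : Set (ThickSubcategory T) := {K | ∀ X ∈ ℰ, ¬ K.carrier X}

lemma biprod_mem_iff (K : ThickSubcategory T) (X Y : T) :
    K.carrier (X ⊞ Y) ↔ K.carrier X ∧ K.carrier Y := by
  constructor
  · intro h
    exact ⟨K.carrier.prop_of_retract ⟨biprod.inl, biprod.fst, biprod.inl_fst⟩ h,
      K.carrier.prop_of_retract ⟨biprod.inr, biprod.snd, biprod.inr_snd⟩ h⟩
  · rintro ⟨h₁, h₂⟩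
    exact K.carrier.ext_of_isTriangulatedClosed₂ _ (binaryBiproductTriangle_distinguished X Y) h₁ h₂

/-- The topology on the set of thick subcategories whose closed subsets are the `Z(ℰ)`. -/
instance : TopologicalSpace (ThickSubcategory T) :=
  TopologicalSpace.ofClosed (Set.range zeroLocus)
    ⟨Set.univ, Set.eq_empty_iff_forall_notMem.2 fun K h => h 0 trivial K.carrier.prop_zero⟩
    (fun A hA => by
      refine ⟨⋃₀ {ℰ | zeroLocus ℰ ∈ A}, Set.Subset.antisymm ?_ ?_⟩
      · intro K hK Z hZ
        obtain ⟨ℰ, rfl⟩ := hA hZ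
        exact fun X hX => hK X ⟨ℰ, hZ, hX⟩
      · rintro K hK X ⟨ℰ, hℰ, hX⟩
        exact hK _ hℰ X hX)
    (by
      rintro _ ⟨ℰ, rfl⟩ _ ⟨ℰ', rfl⟩
      refine ⟨{Z | ∃ X ∈ ℰ, ∃ Y ∈ ℰ', Z = (X ⊞ Y : T)}, Set.Subset.antisymm ?_ ?_⟩
      · intro K hK
        by_contra h
        simp only [zeroLocus, Set.mem_union, Set.mem_ofPred_eq, not_or, not_forall, not_not] at h
        obtain ⟨⟨X, hX, hX'⟩, ⟨Y, hY, hY'⟩⟩ := h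
        exact hK _ ⟨X, hX, Y, hY, rfl⟩ ((K.biprod_mem_iff X Y).2 ⟨hX', hY'⟩)
      · rintro K hK _ ⟨X, hX, Y, hY, rfl⟩ h
        rw [K.biprod_mem_iff] at h
        exact hK.elim (fun hK => hK X hX h.1) (fun hK => hK Y hY h.2))

/-- A prime thick subcategory: a proper thick subcategory `P` such that there is a smallest
thick subcategory among those strictly containing `P`. -/
structure IsPrime (P : ThickSubcategory T) : Prop where
  ne_top : P.carrier ≠ ⊤
  exists_isLeast : ∃ X : ThickSubcategory T, IsLeast {X | P < X} X

end ThickSubcategory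

/-- The triangular spectrum of `T` as a topological space. -/
abbrev Spectrum : Type u := {P : ThickSubcategory T // P.IsPrime}

end Thick

/-! ### Verdier quotients -/

section Verdier

variable {T : Type u₁} [Category.{v₁} T] [Preadditive T] [HasZeroObject T] [HasShift T ℤ]
  [∀ n : ℤ, (shiftFunctor T n).Additive] [Pretriangulated T]
  {T' : Type u₂} [Category.{v₂} T'] [Preadditive T'] [HasZeroObject T'] [HasShift T' ℤ]
  [∀ n : ℤ, (shiftFunctor T' n).Additive] [Pretriangulated T']

/-- The Verdier quotient `T/K`. -/
abbrev VerdierQuotient (K : ThickSubcategory T) : Type u₁ := K.carrier.trW.Localization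

/-- The quotient functor `T ⥤ T/K`. -/
abbrev quotientFunctor (K : ThickSubcategory T) : T ⥤ VerdierQuotient K := K.carrier.trW.Q

variable (Φ : T ⥤ T') [Φ.CommShift ℤ] [Φ.IsTriangulated]
  {A : ThickSubcategory T} {B : ThickSubcategory T'}

lemma quotientMap_inverts (h : ∀ X, A.carrier X → B.carrier (Φ.obj X)) :
    A.carrier.trW.IsInvertedBy (Φ ⋙ quotientFunctor B) := fun _ _ f hf =>
  ObjectProperty.inverseImage_trW_isInverted B.carrier Φ (quotientFunctor B) f
    (ObjectProperty.trW_monotone (Q := B.carrier.inverseImage Φ) h _ hf)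

/-- The functor `T/A ⥤ T'/B` induced by an exact functor `Φ : T ⥤ T'` with `Φ A ⊆ B`. -/
def quotientMap (h : ∀ X, A.carrier X → B.carrier (Φ.obj X)) :
    VerdierQuotient A ⥤ VerdierQuotient B :=
  Localization.lift (Φ ⋙ quotientFunctor B) (quotientMap_inverts Φ h) (quotientFunctor A)

/-- The functor `T/A ⥤ T'/B` induced by `Φ` commutes with the quotient functors. -/
def quotientMapFac (h : ∀ X, A.carrier X → B.carrier (Φ.obj X)) :
    quotientFunctor A ⋙ quotientMap Φ h ≅ Φ ⋙ quotientFunctor B :=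
  Localization.fac _ _ _

end Verdier

section Restriction

variable {T : Type u} [Category.{v} T] [Preadditive T] [HasZeroObject T] [HasShift T ℤ]
  [∀ n : ℤ, (shiftFunctor T n).Additive] [Pretriangulated T] [IsTriangulated T]
  {A B D : ThickSubcategory T}

/-- The canonical functor `T/A ⥤ T/B` for `A ≤ B`. -/
abbrev quotientRes (h : A ≤ B) : VerdierQuotient A ⥤ VerdierQuotient B :=
  quotientMap (𝟭 T) (A := A) (B := B) h

/-- The canonical functor `T/A ⥤ T/B` commutes with the quotient functors. -/
def quotientResFac (h : A ≤ B) :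
    quotientFunctor A ⋙ quotientRes h ≅ quotientFunctor B :=
  quotientMapFac (𝟭 T) (A := A) (B := B) h ≪≫ Functor.leftUnitor _

instance quotientResLifting (h : A ≤ B) :
    Localization.Lifting (quotientFunctor A) A.carrier.trW (quotientFunctor B) (quotientRes h) :=
  ⟨quotientResFac h⟩

instance quotientResCommShift (h : A ≤ B) : (quotientRes h).CommShift ℤ :=
  Functor.commShiftOfLocalization (quotientFunctor A) A.carrier.trW ℤ (quotientFunctor B)
    (quotientRes h)

instance quotientResIsLocalization (h : A ≤ B) :
    (quotientRes h).IsLocalization (B.carrier.trW.map (quotientFunctor A)) := by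
  have : (quotientFunctor A ⋙ quotientRes h).IsLocalization B.carrier.trW :=
    Functor.IsLocalization.of_iso _ (quotientResFac h).symm
  exact Functor.IsLocalization.of_comp (quotientFunctor A) (quotientRes h) A.carrier.trW _
    B.carrier.trW (ObjectProperty.trW_monotone h) rfl

instance quotientResEssSurj (h : A ≤ B) : (quotientRes h).EssSurj :=
  Localization.essSurj _ (B.carrier.trW.map (quotientFunctor A))

instance quotientResAdditive (h : A ≤ B) : (quotientRes h).Additive := by
  rw [Localization.functor_additive_iff (quotientFunctor A) A.carrier.trW]
  exact Functor.additive_of_iso (quotientResFac h).symm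

/-- `(-)_* : Z(T/A) → Z(T/B)` for `A ≤ B`. -/
def centerRes (h : A ≤ B) : Center (VerdierQuotient A) →+* Center (VerdierQuotient B) :=
  centerLocalization (quotientRes h) (B.carrier.trW.map (quotientFunctor A))

lemma centerRes_compatible (h : A ≤ B) (η : Center (VerdierQuotient A)) :
    CenterCompatible (quotientRes h) η (centerRes h η) :=
  centerLocalization_compatible _ _ _

lemma centerRes_refl (η : Center (VerdierQuotient A)) : centerRes (le_refl A) η = η := by
  refine (centerRes_compatible (le_refl A) η).unique (CenterCompatible.of_iso ?_ (.refl η))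
  exact Localization.liftNatIso (quotientFunctor A) A.carrier.trW (quotientFunctor A)
    (quotientFunctor A) _ _ (Iso.refl _)

lemma centerRes_comp (h : A ≤ B) (h' : B ≤ D) (η : Center (VerdierQuotient A)) :
    centerRes h' (centerRes h η) = centerRes (h.trans h') η := by
  refine CenterCompatible.unique (CenterCompatible.of_iso ?_
    ((centerRes_compatible h η).comp (centerRes_compatible h' _))) (centerRes_compatible _ η)
  exact Localization.liftNatIso (quotientFunctor A) A.carrier.trW
    (quotientFunctor A ⋙ quotientRes h ⋙ quotientRes h') (quotientFunctor D) _ _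
    ((Functor.associator _ _ _).symm ≪≫ Functor.isoWhiskerRight (quotientResFac h) _ ≪≫
      quotientResFac h')

/-- The idempotent completion `(T/A)^♮`. -/
abbrev CompletedQuotient (A : ThickSubcategory T) := Karoubi (VerdierQuotient A)

/-- The map `Z((T/A)^♮) → Z((T/B)^♮)` for `A ≤ B`, obtained from `Z(T/A) → Z(T/B)` by
identifying the centers of a category and of its idempotent completion. -/
def completedCenterRes (h : A ≤ B) :
    Center (CompletedQuotient A) →+* Center (CompletedQuotient B) :=
  (karoubiCenterEquiv.toRingHom.comp (centerRes h)).comp karoubiCenterEquiv.symm.toRingHom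

lemma completedCenterRes_compatible (h : A ≤ B) (η : Center (CompletedQuotient A)) :
    CenterCompatible (karoubiMap (quotientRes h)) η (completedCenterRes h η) := by
  have := karoubiCenterEquiv_compatible (centerRes_compatible h (karoubiCenterEquiv.symm η))
  rwa [RingEquiv.apply_symm_apply] at this

/-- The map `Z((T/A)^♮)_lred → Z((T/B)^♮)_lred` for `A ≤ B`. -/
def completedCenterLredRes (h : A ≤ B) :
    CenterLred (CompletedQuotient A) →+* CenterLred (CompletedQuotient B) :=
  Ideal.quotientMap _ (completedCenterRes h) (by
    intro η hη
    change karoubiCenterEquiv (centerRes h (karoubiCenterEquiv.symm η)) ∈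
      lnil (CompletedQuotient B)
    rw [karoubiCenterEquiv_lnil]
    refine lnil_le_comap (quotientRes h) (centerRes h) (centerRes_compatible h) ?_
    rwa [← karoubiCenterEquiv_lnil, RingEquiv.apply_symm_apply])

end Restriction

/-! ### The structure sheaf -/

section StructureSheaf

variable {T : Type u} [Category.{v} T] [Preadditive T] [HasZeroObject T] [HasShift T ℤ]
  [∀ n : ℤ, (shiftFunctor T n).Additive] [Pretriangulated T]

/-- `T^U`, the intersection of all primes in `U`. -/
def kernelOn (U : Opens (Spectrum T)) : ThickSubcategory T :=
  sInf {K | ∃ P ∈ U, K = P.1}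

lemma kernelOn_antitone {U V : Opens (Spectrum T)} (h : U ≤ V) : kernelOn V ≤ kernelOn U := by
  intro X hX K ⟨P, hP, hK⟩
  subst hK
  exact hX _ ⟨P, h hP, rfl⟩

variable (T) [IsTriangulated T]

/-- `T(U) = (T/T^U)^♮`. -/
abbrev LocalCategory (U : Opens (Spectrum T)) := CompletedQuotient (kernelOn U)

/-- The presheaf `U ↦ Z(T(U))_lred`. -/
def structurePresheaf : (TopCat.of (Spectrum T)).Presheaf CommRingCat.{max u v} where
  obj U := CommRingCat.of (CenterLred (LocalCategory T U.unop))
  map f := CommRingCat.ofHom (completedCenterLredRes (kernelOn_antitone f.unop.le))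
  map_id U := by
    ext η
    change Ideal.Quotient.mk _ (completedCenterRes _ η) = Ideal.Quotient.mk _ η
    congr 1
    change karoubiCenterEquiv (centerRes _ (karoubiCenterEquiv.symm η)) = η
    rw [centerRes_refl, RingEquiv.apply_symm_apply]
  map_comp {U V W} f g := by
    ext η
    change Ideal.Quotient.mk _ (completedCenterRes _ η) =
      Ideal.Quotient.mk _ (completedCenterRes _ (completedCenterRes _ η))
    congr 1
    change karoubiCenterEquiv (centerRes _ (karoubiCenterEquiv.symm η)) =
      karoubiCenterEquiv (centerRes _ (karoubiCenterEquiv.symm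
        (karoubiCenterEquiv (centerRes _ (karoubiCenterEquiv.symm η)))))
    rw [RingEquiv.symm_apply_apply, centerRes_comp]

instance hasSheafifySpectrum :
    HasSheafify (Opens.grothendieckTopology (TopCat.of (Spectrum T))) CommRingCat.{max u v} := by
  let X := TopCat.of (Spectrum T)
  have h₁ : ∀ U : Opens X, Small.{max u v} (((Opens.grothendieckTopology X).Cover U)ᵒᵖ) :=
    fun U => small_max.{v} _
  have h₂ : HasColimitsOfSize.{u, u} CommRingCat.{max u v} :=
    hasColimitsOfSizeShrink.{u, u, max u v, max u v} _
  have h₃ : PreservesFilteredColimitsOfSize.{u, u} (forget CommRingCat.{max u v}) :=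
    preservesFilteredColimitsOfSize_shrink.{u, max u v, u, max u v} _
  infer_instance

/-- The triangular spectrum `Spec_△(T)` as a ringed space. -/
def triangularSpectrum : AlgebraicGeometry.RingedSpace.{max u v, u} where
  carrier := TopCat.of (Spectrum T)
  presheaf := sheafify (Opens.grothendieckTopology _) (structurePresheaf T)
  IsSheaf := ((presheafToSheaf _ _).obj (structurePresheaf T)).2

variable {T} in
/-- The section of the structure sheaf over `U` given by an element of the center of `T(U)`. -/
def sectionOf {U : Opens (Spectrum T)} (η : Center (LocalCategory T U)) :
    (triangularSpectrum T).presheaf.obj (op U) :=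
  (toSheafify (Opens.grothendieckTopology (TopCat.of (Spectrum T))) (structurePresheaf T)).app
    (op U) (Ideal.Quotient.mk (lnil (LocalCategory T U)) η)

end StructureSheaf

/-! ### Morphisms of triangular spectra induced by exact functors -/

section Induced

variable {T : Type u₁} [Category.{v₁} T] [Preadditive T] [HasZeroObject T] [HasShift T ℤ]
  [∀ n : ℤ, (shiftFunctor T n).Additive] [Pretriangulated T]
  {T' : Type u₂} [Category.{v₂} T'] [Preadditive T'] [HasZeroObject T'] [HasShift T' ℤ]
  [∀ n : ℤ, (shiftFunctor T' n).Additive] [Pretriangulated T']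
  (Φ : T ⥤ T')

/-- `Φ` is dense if every object of `T'` is a direct summand of an object in the image of `Φ`. -/
def IsDenseFunctor : Prop :=
  ∀ M' : T', ∃ (M : T) (N' : T'), Nonempty (Φ.obj M ≅ M' ⊞ N')

lemma kernelOn_map (b : C(Spectrum T', Spectrum T))
    (hb : ∀ P : Spectrum T', (b P).1.carrier = P.1.carrier.inverseImage Φ)
    (V : Opens (Spectrum T)) (X : T) (hX : (kernelOn V).carrier X) :
    (kernelOn (V.comap b)).carrier (Φ.obj X) := by
  intro K ⟨P, hP, hK⟩
  subst hK
  have h : (b P).1.carrier X := hX _ ⟨b P, hP, rfl⟩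
  rw [hb P] at h
  exact h

variable [IsTriangulated T] [IsTriangulated T'] [Φ.CommShift ℤ] [Φ.IsTriangulated]

/-- A continuous map `b : Spec_△(T') → Spec_△(T)` together with ring homomorphisms
`c V : 𝒪_T(V) → 𝒪_{T'}(b⁻¹ V)` is induced by the exact functor `Φ : T ⥤ T'` if `b P = Φ⁻¹ P` for
all `P`, and if `c V` sends the section given by an element `η` of the center of `T(V)` to the
section given by an element `θ` of the center of `T'(b⁻¹ V)` which corresponds to `η`
under the functor `T(V) ⥤ T'(b⁻¹ V)` induced by `Φ`. -/
structure IsInducedBy (b : C(Spectrum T', Spectrum T))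
    (c : ∀ V : Opens (Spectrum T), (triangularSpectrum T).presheaf.obj (op V) →+*
      (triangularSpectrum T').presheaf.obj (op (V.comap b))) : Prop where
  base : ∀ P : Spectrum T', (b P).1.carrier = P.1.carrier.inverseImage Φ
  sections : ∀ (V : Opens (Spectrum T)) (η : Center (LocalCategory T V)),
    ∃ θ : Center (LocalCategory T' (V.comap b)),
      CenterCompatible (karoubiMap (quotientMap Φ (kernelOn_map Φ b base V))) η θ ∧
        c V (sectionOf η) = sectionOf θ

end Induced

end TriangularSpectrum

end

open TriangularSpectrum

/-! Both kinds of functor, quotient functors and fully faithful dense functors, satisfy the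
conditions collected in `IsSpectralEmbedding`, and everything about spectra is derived from these.

On spaces: an object `M'` lies in exactly the same thick subcategories of `T'` as some `Φ M`, so `L
↦ Φ⁻¹ L` is an order embedding compatible with the zero loci. Its image contains every thick
subcategory above one of its members, so the smallest thick subcategory strictly above `L` exists
exactly when the one above `Φ⁻¹ L` does. Hence primes correspond (`isPrime_comap_iff`) and the map
of spectra is a topological embedding (`isEmbedding`).

On sections: every object of `T'/B` is a retract of an object coming from `T/A`, so a central
element of `T'/B` is determined by its values there; this gives uniqueness. It exists because `T/A ⥤
T'/B` factors as a localization `T/A ⥤ T/Φ⁻¹B` followed by a fully faithful functor: central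
elements descend along the first and extend over retracts along the second
(`exists_centerCompatible`). If `A = Φ⁻¹ B`, the centers agree, and so do their locally nilpotent
ideals. For open `V` inside the image this is the case, because `T^V` is the preimage of its
counterpart (`kernelOn_iff`). So the map of presheaves is bijective on the open subsets of an open
image, and sheafification preserves this (`isIso_app_of_sheafification`).

The image of `Spec(T/K)` consists of the primes containing `K`; for `K = ⟨M⟩` these are the primes
containing `M`, an open condition. For a dense `Φ` every thick subcategory of `T` is a preimage, so
the open immersion is surjective, hence an isomorphism. -/

noncomputable section

namespace TriangularSpectrum

/-! ### Inverse images of thick subcategories -/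

section Comap

variable {T : Type u₁} [Category.{v₁} T] [Preadditive T] [HasZeroObject T] [HasShift T ℤ]
  [∀ n : ℤ, (shiftFunctor T n).Additive] [Pretriangulated T]
  {T' : Type u₂} [Category.{v₂} T'] [Preadditive T'] [HasZeroObject T'] [HasShift T' ℤ]
  [∀ n : ℤ, (shiftFunctor T' n).Additive] [Pretriangulated T']

namespace ThickSubcategory

/-- The inverse image of a thick subcategory under an exact functor. -/
def comap (Φ : T ⥤ T') [Φ.CommShift ℤ] [Φ.IsTriangulated] (L : ThickSubcategory T') :
    ThickSubcategory T where
  carrier := L.carrier.inverseImage Φ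
  isTriangulated := inferInstance
  isStableUnderRetracts := ⟨fun r h => L.carrier.prop_of_retract (r.map Φ) h⟩

lemma carrier_of_comap (Φ : T ⥤ T') [Φ.CommShift ℤ] [Φ.IsTriangulated] (L : ThickSubcategory T')
    (X : T) (h : (L.comap Φ).carrier X) : L.carrier (Φ.obj X) := h

variable (T) in
/-- The thick subcategory of zero objects. -/
def zero : ThickSubcategory T where
  carrier := fun X => IsZero X
  isStableUnderRetracts :=
    { of_retract := fun r h => by
        rw [IsZero.iff_id_eq_zero, ← r.retract, h.eq_of_tgt r.i 0, zero_comp] }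
  isTriangulated :=
    { exists_zero := ⟨0, isZero_zero T, isZero_zero T⟩
      isStableUnderShiftBy := fun n =>
        { le_shift := fun X h => (shiftFunctor T n).map_isZero h }
      ext₂' := fun D hD h₁ h₃ => ObjectProperty.le_isoClosure _ _ (by
        have : IsIso D.mor₁ := (Triangle.isZero₃_iff_isIso₁ _ hD).1 h₃
        exact h₁.of_iso (asIso D.mor₁).symm) }

end ThickSubcategory

/-- The target of a zero morphism is a direct summand of its cone. -/
lemma ThickSubcategory.carrier_of_trW_zero (K : ThickSubcategory T) {X Y : T}
    (h : K.carrier.trW (0 : X ⟶ Y)) : K.carrier Y := by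
  obtain ⟨Z, g, k, hT, hZ⟩ := h
  obtain ⟨r, hr⟩ := Triangle.yoneda_exact₂ _ hT (𝟙 Y) zero_comp
  exact K.carrier.prop_of_retract ⟨g, r, hr.symm⟩ hZ

/-- A functor satisfying these conditions induces an immersion of triangular spectra. -/
structure IsSpectralEmbedding (Φ : T ⥤ T') [Φ.CommShift ℤ] [Φ.IsTriangulated] : Prop where
  exists_carrier_iff (M' : T') :
    ∃ M : T, ∀ L : ThickSubcategory T', L.carrier M' ↔ L.carrier (Φ.obj M)
  exists_retract (M' : T') : ∃ M : T, Nonempty (Retract M' (Φ.obj M))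
  exists_comap_eq (L : ThickSubcategory T') (K : ThickSubcategory T) (h : L.comap Φ ≤ K) :
    ∃ L' : ThickSubcategory T', L'.comap Φ = K
  full (L : ThickSubcategory T') : (quotientMap Φ (L.carrier_of_comap Φ)).Full
  faithful (L : ThickSubcategory T') : (quotientMap Φ (L.carrier_of_comap Φ)).Faithful

end Comap

/-! ### Verdier quotient functors as spectral embeddings -/

section Quotient

variable {T : Type u} [Category.{v} T] [Preadditive T] [HasZeroObject T] [HasShift T ℤ]
  [∀ n : ℤ, (shiftFunctor T n).Additive] [Pretriangulated T] [IsTriangulated T]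

/-- If `X` becomes zero, its identity is identified with `0`, so by calculus of fractions some zero
morphism into `X` has its cone in `K`; then `X` is a summand of that cone. Thickness of `K` is what
makes the kernel no larger than `K`. -/
lemma isZero_quotientFunctor_obj_iff (K : ThickSubcategory T) (X : T) :
    IsZero ((quotientFunctor K).obj X) ↔ K.carrier X := by
  constructor
  · intro h
    have h₁ : (quotientFunctor K).map (𝟙 X) = (quotientFunctor K).map 0 := h.eq_of_src _ _
    obtain ⟨Y, s, hs, h₂⟩ :=
      (MorphismProperty.map_eq_iff_precomp (quotientFunctor K) K.carrier.trW _ _).1 h₁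
    rw [Category.comp_id, comp_zero] at h₂
    exact K.carrier_of_trW_zero (h₂ ▸ hs)
  · intro h
    have h₁ : K.carrier.trW (0 : X ⟶ 0) :=
      ObjectProperty.trW.mk' _ (contractible_distinguished X) h
    have := Localization.inverts (quotientFunctor K) K.carrier.trW _ h₁
    exact ((quotientFunctor K).map_isZero (isZero_zero T)).of_iso
      (asIso ((quotientFunctor K).map (0 : X ⟶ 0)))

instance quotientFunctor_essSurj (K : ThickSubcategory T) : (quotientFunctor K).EssSurj :=
  Localization.essSurj _ K.carrier.trW

instance quotientFunctor_mapArrow_essSurj (K : ThickSubcategory T) :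
    (quotientFunctor K).mapArrow.EssSurj :=
  Localization.essSurj_mapArrow _ K.carrier.trW

instance quotientRes_isTriangulated {A B : ThickSubcategory T} (h : A ≤ B) :
    (quotientRes h).IsTriangulated := by
  have : NatTrans.CommShift (quotientResFac h).hom ℤ :=
    NatTrans.commShift_iso_hom_of_localization (quotientFunctor A) A.carrier.trW ℤ
      (quotientFunctor B) (quotientRes h)
  exact Functor.isTriangulated_of_precomp_iso (quotientResFac h)

/-- The witness is the kernel of the canonical functor `T/K ⥤ T/P`. -/
lemma exists_comap_quotientFunctor_eq {K P : ThickSubcategory T} (h : K ≤ P) :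
    ∃ L : ThickSubcategory (VerdierQuotient K), L.comap (quotientFunctor K) = P := by
  refine ⟨(ThickSubcategory.zero _).comap (quotientRes h), ThickSubcategory.ext ?_⟩
  ext X
  refine Iff.trans ?_ (isZero_quotientFunctor_obj_iff P X)
  exact ((quotientResFac h).app X).isZero_iff

lemma le_comap_quotientFunctor (K : ThickSubcategory T)
    (L : ThickSubcategory (VerdierQuotient K)) : K ≤ L.comap (quotientFunctor K) := fun X hX =>
  L.carrier.prop_of_isZero ((isZero_quotientFunctor_obj_iff K X).2 hX)

/-- The third isomorphism theorem for Verdier quotients: `(T/K)/L` is the quotient of `T` by the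
preimage of `L`. -/
lemma isLocalization_quotientFunctor_comp (K : ThickSubcategory T)
    (L : ThickSubcategory (VerdierQuotient K)) :
    (quotientFunctor K ⋙ quotientFunctor L).IsLocalization
      (L.comap (quotientFunctor K)).carrier.trW := by
  refine Functor.IsLocalization.comp (quotientFunctor K) (quotientFunctor L) K.carrier.trW
    L.carrier.trW _ (quotientMap_inverts _ (L.carrier_of_comap _))
    (ObjectProperty.trW_monotone (le_comap_quotientFunctor K L)) ?_
  intro X Y f hf
  -- Up to isomorphism of arrows, every morphism of `T/K` comes from `T`, and whether its cone lies
  -- in `L` can be tested on such a representative.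
  let e := (quotientFunctor K).mapArrow.objObjPreimageIso (Arrow.mk f)
  refine ⟨_, _, ((quotientFunctor K).mapArrow.objPreimage (Arrow.mk f)).hom, ?_, ⟨e⟩⟩
  refine (ObjectProperty.inverseImage_trW_iff L.carrier (quotientFunctor K) _).2 ?_
  exact (L.carrier.trW.arrow_mk_iso_iff e).2 hf

lemma quotientMap_quotientFunctor_isEquivalence (K : ThickSubcategory T)
    (L : ThickSubcategory (VerdierQuotient K)) :
    (quotientMap (quotientFunctor K) (L.carrier_of_comap (quotientFunctor K))).IsEquivalence := by
  let A := L.comap (quotientFunctor K)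
  have := isLocalization_quotientFunctor_comp K L
  have : Localization.Lifting (quotientFunctor A) A.carrier.trW
      (quotientFunctor K ⋙ quotientFunctor L) (quotientMap (quotientFunctor K)
        (L.carrier_of_comap (quotientFunctor K))) := ⟨quotientMapFac _ _⟩
  let E := Localization.uniq (quotientFunctor A) (quotientFunctor K ⋙ quotientFunctor L)
    A.carrier.trW
  refine Functor.isEquivalence_of_iso (F := E.functor) (Localization.liftNatIso (quotientFunctor A)
    A.carrier.trW (quotientFunctor K ⋙ quotientFunctor L) (quotientFunctor K ⋙ quotientFunctor L)
    _ _ (Iso.refl _))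

theorem isSpectralEmbedding_quotientFunctor (K : ThickSubcategory T) :
    IsSpectralEmbedding (quotientFunctor K) where
  exists_carrier_iff M' := ⟨(quotientFunctor K).objPreimage M', fun L =>
    L.carrier.prop_iff_of_iso ((quotientFunctor K).objObjPreimageIso M').symm⟩
  exists_retract M' := ⟨(quotientFunctor K).objPreimage M',
    ⟨((quotientFunctor K).objObjPreimageIso M').symm.retract⟩⟩
  exists_comap_eq L P h := exists_comap_quotientFunctor_eq ((le_comap_quotientFunctor K L).trans h)
  full L := by
    have := quotientMap_quotientFunctor_isEquivalence K L
    infer_instance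
  faithful L := by
    have := quotientMap_quotientFunctor_isEquivalence K L
    infer_instance

end Quotient

end TriangularSpectrum

end

noncomputable section

namespace TriangularSpectrum

/-! ### Fully faithful dense functors -/

section DenseFunctor

variable {T : Type u₁} [Category.{v₁} T] [Preadditive T] [HasZeroObject T] [HasShift T ℤ]
  [∀ n : ℤ, (shiftFunctor T n).Additive] [Pretriangulated T]
  {T' : Type u₂} [Category.{v₂} T'] [Preadditive T'] [HasZeroObject T'] [HasShift T' ℤ]
  [∀ n : ℤ, (shiftFunctor T' n).Additive] [Pretriangulated T']

/-- The retract closure of a triangulated subcategory is thick. -/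
def ThickSubcategory.ofRetractClosure (P : ObjectProperty T) [P.IsTriangulated]
    [P.IsClosedUnderIsomorphisms] : ThickSubcategory T where
  carrier := P.retractClosure
  isStableUnderRetracts := inferInstance
  isTriangulated :=
    { exists_zero := by
        obtain ⟨Z, hZ, h⟩ := P.exists_prop_of_containsZero
        exact ⟨Z, hZ, P.le_retractClosure _ h⟩
      isStableUnderShiftBy := fun n =>
        { le_shift := by
            rintro X ⟨Y, hY, ⟨r⟩⟩
            exact ⟨Y⟦n⟧, P.le_shift n Y hY, ⟨r.map (shiftFunctor T n)⟩⟩ }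
      ext₂' := fun D hD h₁ h₃ => ObjectProperty.le_isoClosure _ _ (by
        obtain ⟨X, hX, r⟩ := P.extensionProduct_retractClosure_retractClosure_le P D.obj₂
          ⟨_, _, _, _, _, hD, h₁, h₃⟩
        exact ⟨X, ObjectProperty.extensionProduct_le_of_isTriangulatedClosed₂ le_rfl le_rfl _ hX,
          r⟩) }

variable (Φ : T ⥤ T') [Φ.CommShift ℤ] [Φ.IsTriangulated]

/-- The functor `Φ` maps the cone `D` of an idempotent of `M` with image `N'` to `M' ⊞ M'⟦1⟧`,
where `Φ M = M' ⊞ N'`. -/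
lemma IsDenseFunctor.exists_retract [IsTriangulated T'] [Φ.Full] (hΦ : IsDenseFunctor Φ) (M' : T') :
    ∃ D : T, Nonempty (Retract M' (Φ.obj D)) ∧
      ∀ L : ThickSubcategory T', L.carrier M' → L.carrier (Φ.obj D) := by
  obtain ⟨M, N', ⟨e⟩⟩ := hΦ M'
  -- `g` lifts the projection of `Φ M` onto the complement `N'`, followed by its inclusion.
  obtain ⟨g, hg⟩ := Φ.map_surjective (e.hom ≫ biprod.snd ≫ biprod.inr ≫ e.inv)
  obtain ⟨D, b, c, hT⟩ := distinguished_cocone_triangle g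
  have hT' := Φ.map_distinguished _ hT
  refine ⟨D, ?_, fun L hL => ?_⟩
  -- The projection `Φ M ⟶ M'` kills `Φ g`, so it factors through the cone; this exhibits `M'` as a
  -- retract of `Φ D`.
  · obtain ⟨r, hr⟩ : ∃ r : Φ.obj D ⟶ M', e.hom ≫ biprod.fst = Φ.map b ≫ r :=
      Triangle.yoneda_exact₂ _ hT' (e.hom ≫ biprod.fst : Φ.obj M ⟶ M') (by
        change Φ.map g ≫ _ = 0
        simp [hg])
    exact ⟨biprod.inl ≫ e.inv ≫ Φ.map b, r, by simp [← hr]⟩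
  · refine (L.carrier.trW_iff_of_distinguished _ hT').1 ?_
    change L.carrier.trW (Φ.map g)
    -- The projection to `N'` and the inclusion of `N'` both have cones built from `M'`, so `Φ g` is
    -- inverted modulo `L` and its cone `Φ D` lies in `L`.
    have h₁ : L.carrier.trW (biprod.snd : M' ⊞ N' ⟶ N') :=
      ObjectProperty.trW.mk' _ (binaryBiproductTriangle_distinguished M' N') hL
    have h₂ : L.carrier.trW (biprod.inl : N' ⟶ N' ⊞ M') :=
      ObjectProperty.trW.mk _ (binaryBiproductTriangle_distinguished N' M') hL
    have h₃ : (biprod.inr : N' ⟶ M' ⊞ N') = biprod.inl ≫ (biprod.braiding N' M').hom := by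
      ext <;> simp
    rw [hg, h₃, Category.assoc]
    exact L.carrier.trW.comp_mem _ _ (L.carrier.trW_of_isIso _)
      (L.carrier.trW.comp_mem _ _ h₁ (L.carrier.trW.comp_mem _ _ h₂ (L.carrier.trW_of_isIso _)))

/-- The witness is the retract closure of the image of `K`. It pulls back to `K` because full
faithfulness turns a retraction of `Φ Y` onto `Φ X` into one of `Y` onto `X`. -/
lemma IsDenseFunctor.exists_comap_eq [Φ.Full] [Φ.Faithful] (K : ThickSubcategory T) :
    ∃ L : ThickSubcategory T', L.comap Φ = K := by
  refine ⟨.ofRetractClosure (K.carrier.map Φ), ThickSubcategory.ext ?_⟩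
  ext X
  constructor
  · rintro ⟨Z, ⟨Y, hY, ⟨e⟩⟩, ⟨r⟩⟩
    refine K.carrier.prop_of_retract (Y := Y)
      ⟨Φ.preimage (r.i ≫ e.inv), Φ.preimage (e.hom ≫ r.r), Φ.map_injective ?_⟩ hY
    simp
  · exact fun hX => ObjectProperty.le_retractClosure _ _ (K.carrier.prop_map_obj Φ hX)

/-- A cofinality statement: denominators starting at an object `Φ Y` can be enlarged to denominators
coming from `T`. The fibre `N'` of `s` is a retract of some `Φ N` with `Φ N` in `L`; the composite
`Φ N ⟶ N' ⟶ Φ Y` lifts to `T`, and `t` is the map from `Y` to the cone of the lift. The inclusion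
`N' ⟶ Φ N` extends to a morphism of triangles, which supplies `k`. -/
lemma IsDenseFunctor.exists_trW [IsTriangulated T'] [Φ.Full] [Φ.Faithful] (hΦ : IsDenseFunctor Φ)
    (L : ThickSubcategory T') {Y : T} {Z' : T'} (s : Φ.obj Y ⟶ Z') (hs : L.carrier.trW s) :
    ∃ (Z : T) (t : Y ⟶ Z) (k : Z' ⟶ Φ.obj Z), (L.comap Φ).carrier.trW t ∧ s ≫ k = Φ.map t := by
  rw [ObjectProperty.trW_iff'] at hs
  obtain ⟨N', a, c, hT, hN'⟩ := hs
  obtain ⟨N, ⟨r⟩, hN⟩ := hΦ.exists_retract Φ N'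
  obtain ⟨b, hb⟩ := Φ.map_surjective (r.r ≫ a)
  obtain ⟨Z, t, d, hT'⟩ := distinguished_cocone_triangle b
  obtain ⟨k, hk⟩ : ∃ k : Z' ⟶ Φ.obj Z, s ≫ k = 𝟙 _ ≫ Φ.map t := by
    obtain ⟨k, hk, -⟩ := complete_distinguished_triangle_morphism _ _ hT
      (Φ.map_distinguished _ hT') r.i (𝟙 _) (by
        change a ≫ 𝟙 _ = r.i ≫ Φ.map b
        rw [hb, r.retract_assoc, Category.comp_id])
    exact ⟨k, hk⟩
  exact ⟨Z, t, k, ObjectProperty.trW.mk' _ hT' (hN L hN'), by rw [hk, Category.id_comp]⟩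

variable [IsTriangulated T']

/-- Represent a morphism by a left fraction, enlarge its denominator to some `Φ t` by `exists_trW`,
and lift the new numerator by fullness of `Φ`. -/
lemma IsDenseFunctor.quotientMap_full [Φ.Full] [Φ.Faithful] (hΦ : IsDenseFunctor Φ)
    (L : ThickSubcategory T') :
    (quotientMap Φ (L.carrier_of_comap Φ)).Full := by
  let A := L.comap Φ
  let F := quotientMap Φ (L.carrier_of_comap Φ)
  let e : quotientFunctor A ⋙ F ≅ Φ ⋙ quotientFunctor L := quotientMapFac Φ _
  refine Functor.full_of_comp_essSurj F (quotientFunctor A) fun X₁ X₂ φ => ?_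
  obtain ⟨f, hf⟩ := Localization.exists_leftFraction (quotientFunctor L) L.carrier.trW
    (e.inv.app X₁ ≫ φ ≫ e.hom.app X₂)
  obtain ⟨Z, t, k, ht, hk⟩ := hΦ.exists_trW Φ L f.s f.hs
  obtain ⟨g, hg⟩ := Φ.map_surjective (f.f ≫ k)
  have := Localization.inverts (quotientFunctor A) A.carrier.trW t ht
  have h₁ : (e.inv.app X₁ ≫ φ ≫ e.hom.app X₂) ≫ (quotientFunctor L).map (Φ.map t) =
      (quotientFunctor L).map (Φ.map g) := by
    rw [hf, ← hk, hg, Functor.map_comp, Functor.map_comp,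
      MorphismProperty.LeftFraction.map_comp_map_s_assoc]
  refine ⟨(quotientFunctor A).map g ≫ inv ((quotientFunctor A).map t), ?_⟩
  rw [Functor.map_comp, Functor.map_inv, IsIso.comp_inv_eq, ← cancel_mono (e.hom.app Z),
    ← cancel_epi (e.inv.app X₁)]
  have h₂ := e.hom.naturality g
  have h₃ := e.hom.naturality t
  dsimp at h₁ h₂ h₃ ⊢
  rw [Category.assoc, h₂, h₃, ← Category.assoc φ, ← Category.assoc (e.inv.app X₁) (φ ≫ _), h₁]
  exact e.inv_hom_id_app_assoc X₁ _

variable [IsTriangulated T]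

instance quotientMap_additive {A : ThickSubcategory T} {B : ThickSubcategory T'}
    (h : ∀ X, A.carrier X → B.carrier (Φ.obj X)) : (quotientMap Φ h).Additive := by
  rw [Localization.functor_additive_iff (quotientFunctor A) A.carrier.trW]
  exact Functor.additive_of_iso (quotientMapFac Φ h).symm

/-- By calculus of fractions it suffices to treat `f` coming from `T`. If `Φ f` dies modulo `L`, it
is killed by some denominator, hence by a larger one `Φ t`; then `f ≫ t = 0` already in `T`. -/
lemma IsDenseFunctor.quotientMap_faithful [Φ.Full] [Φ.Faithful] (hΦ : IsDenseFunctor Φ)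
    (L : ThickSubcategory T') :
    (quotientMap Φ (L.carrier_of_comap Φ)).Faithful := by
  let A := L.comap Φ
  refine Functor.faithful_of_comp_cancel_zero_of_hasLeftCalculusOfFractions (quotientFunctor A)
    A.carrier.trW (quotientMap Φ (L.carrier_of_comap Φ)) fun X₁ X₂ f hf => ?_
  have h₁ : (quotientFunctor L).map (Φ.map f) = (quotientFunctor L).map 0 := by
    have h₂ := (quotientMapFac Φ (L.carrier_of_comap Φ)).hom.naturality f
    rw [Functor.comp_map, hf, zero_comp] at h₂
    rw [Functor.map_zero, ← cancel_epi ((quotientMapFac Φ (L.carrier_of_comap Φ)).hom.app X₁), comp_zero]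
    exact h₂.symm
  obtain ⟨Z', s, hs, h₂⟩ :=
    (MorphismProperty.map_eq_iff_postcomp (quotientFunctor L) L.carrier.trW _ _).1 h₁
  obtain ⟨Z, t, k, ht, hk⟩ := hΦ.exists_trW Φ L s hs
  have := Localization.inverts (quotientFunctor A) A.carrier.trW t ht
  rw [← cancel_mono ((quotientFunctor A).map t), zero_comp, ← Functor.map_comp]
  have h₃ : f ≫ t = 0 := Φ.map_injective (by
    rw [Φ.map_comp, ← hk, reassoc_of% h₂, zero_comp, Φ.map_zero])
  rw [h₃, Functor.map_zero]

theorem IsDenseFunctor.isSpectralEmbedding [Φ.Full] [Φ.Faithful] (hΦ : IsDenseFunctor Φ) :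
    IsSpectralEmbedding Φ where
  exists_carrier_iff M' := by
    obtain ⟨D, ⟨r⟩, h⟩ := hΦ.exists_retract Φ M'
    exact ⟨D, fun L => ⟨h L, L.carrier.prop_of_retract r⟩⟩
  exists_retract M' := by
    obtain ⟨D, r, -⟩ := hΦ.exists_retract Φ M'
    exact ⟨D, r⟩
  exists_comap_eq _ K _ := IsDenseFunctor.exists_comap_eq Φ K
  full := hΦ.quotientMap_full Φ
  faithful := hΦ.quotientMap_faithful Φ

end DenseFunctor

end TriangularSpectrum

end

noncomputable section

namespace TriangularSpectrum

/-! ### Centers along dense functors -/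

section DenseCenter

variable {C : Type u₁} [Category.{v₁} C] {D : Type u₂} [Category.{v₂} D]

/-- Every object of `D` is a retract of an object in the image of `F`. -/
def IsRetractDense (F : C ⥤ D) : Prop := ∀ Y : D, ∃ X : C, Nonempty (Retract Y (F.obj X))

lemma IsRetractDense.karoubiMap {F : C ⥤ D} (hF : IsRetractDense F) :
    IsRetractDense (karoubiMap F) := fun P => by
  obtain ⟨X, ⟨r⟩⟩ := hF P.X
  exact ⟨(toKaroubi C).obj X, ⟨⟨⟨P.p ≫ r.i, by
    change P.p ≫ (P.p ≫ r.i) ≫ F.map (𝟙 X) = P.p ≫ r.i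
    simp⟩, ⟨r.r ≫ P.p, by
    change F.map (𝟙 X) ≫ (r.r ≫ P.p) ≫ P.p = r.r ≫ P.p
    simp⟩, by
    ext
    change (P.p ≫ r.i) ≫ r.r ≫ P.p = P.p
    simp⟩⟩⟩

variable [Preadditive C] [HasShift C ℤ] [∀ n : ℤ, (shiftFunctor C n).Additive]
  [Preadditive D] [HasShift D ℤ] [∀ n : ℤ, (shiftFunctor D n).Additive]
  {F : C ⥤ D}

/-- By naturality, the value of a central element at an object determines its value at every retract
of that object. -/
lemma IsRetractDense.center_eq (hF : IsRetractDense F) {η : Center C} {θ θ' : Center D}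
    (h : CenterCompatible F η θ) (h' : CenterCompatible F η θ') : θ = θ' := by
  apply Subtype.ext
  apply CatCenter.ext
  intro Y
  obtain ⟨X, ⟨r⟩⟩ := hF Y
  rw [← cancel_mono r.i, ← CatCenter.naturality, ← CatCenter.naturality, h, h']

lemma CenterCompatible.one : CenterCompatible F (1 : Center C) (1 : Center D) :=
  fun X => (F.map_id X).symm

lemma CenterCompatible.mul {η η' : Center C} {θ θ' : Center D} (h : CenterCompatible F η θ)
    (h' : CenterCompatible F η' θ') : CenterCompatible F (η * η') (θ * θ') := fun X => by
  change θ'.1.app _ ≫ θ.1.app _ = F.map (η'.1.app X ≫ η.1.app X)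
  rw [h, h', F.map_comp]

lemma CenterCompatible.pow {η : Center C} {θ : Center D} (h : CenterCompatible F η θ) (n : ℕ) :
    CenterCompatible F (η ^ n) (θ ^ n) := by
  induction n with
  | zero => simpa only [pow_zero] using CenterCompatible.one
  | succ n ih => simpa only [pow_succ] using ih.mul h

lemma CenterCompatible.zero [F.Additive] : CenterCompatible F (0 : Center C) (0 : Center D) :=
  fun X => (F.map_zero X X).symm

lemma CenterCompatible.add [F.Additive] {η η' : Center C} {θ θ' : Center D}
    (h : CenterCompatible F η θ) (h' : CenterCompatible F η' θ') :
    CenterCompatible F (η + η') (θ + θ') := fun X => by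
  change θ.1.app (F.obj X) + θ'.1.app (F.obj X) = F.map (η.1.app X + η'.1.app X)
  rw [h, h', F.map_add]

lemma CenterCompatible.mem_lnil [F.Additive] (hF : IsRetractDense F) {η : Center C} {θ : Center D}
    (h : CenterCompatible F η θ) (hη : η ∈ lnil C) : θ ∈ lnil D := fun Y => by
  obtain ⟨X, ⟨r⟩⟩ := hF Y
  obtain ⟨n, hn⟩ := hη X
  refine ⟨n, ?_⟩
  rw [← Center.endo_pow] at hn ⊢
  have h₁ := h.pow n X
  have h₂ : (η ^ n).1.app X = 0 := hn
  rw [h₂, F.map_zero] at h₁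
  change (θ ^ n).1.app Y = 0
  rw [← cancel_mono r.i, ← CatCenter.naturality, h₁, comp_zero, zero_comp]

lemma CenterCompatible.mem_lnil_of_faithful [F.Additive] [F.Faithful] {η : Center C} {θ : Center D}
    (h : CenterCompatible F η θ) (hθ : θ ∈ lnil D) : η ∈ lnil C := fun X => by
  obtain ⟨n, hn⟩ := hθ (F.obj X)
  refine ⟨n, ?_⟩
  rw [← Center.endo_pow] at hn ⊢
  have h₂ : (θ ^ n).1.app (F.obj X) = 0 := hn
  rw [h.pow n X] at h₂
  exact F.map_injective (h₂.trans (F.map_zero X X).symm)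

variable (F) in
lemma exists_centerCompatible_left [F.Full] [F.Faithful] [F.CommShift ℤ] (θ : Center D) :
    ∃ η : Center C, CenterCompatible F η θ := by
  refine ⟨⟨{ app := fun X => F.preimage (θ.1.app (F.obj X))
             naturality := fun X Y f => F.map_injective ?_ }, fun X => F.map_injective ?_⟩,
    fun X => (F.map_preimage _).symm⟩
  · change F.map (f ≫ _) = F.map (_ ≫ f)
    rw [F.map_comp, F.map_comp, F.map_preimage, F.map_preimage, CatCenter.naturality]
  · change F.map (F.preimage _) = F.map ((F.preimage _)⟦(1 : ℤ)⟧')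
    rw [F.map_preimage, ← cancel_mono ((F.commShiftIso (1 : ℤ)).hom.app X),
      ← CatCenter.naturality]
    have h := (F.commShiftIso (1 : ℤ)).hom.naturality (F.preimage (θ.1.app (F.obj X)))
    refine Eq.trans ?_ h.symm
    change _ ≫ θ.1.app ((F.obj X)⟦(1 : ℤ)⟧) = _ ≫ (F.map (F.preimage _))⟦(1 : ℤ)⟧'
    rw [F.map_preimage, θ.2]

-- Compressing `F (η X)` to a retract is natural in the retract: fullness lifts `r.r ≫ g ≫ r'.i` to
-- `C`, where `η` is natural. For `g = 𝟙` this says that the compression does not depend on the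
-- chosen retraction.
omit [Preadditive D] [HasShift D ℤ] [∀ n : ℤ, (shiftFunctor D n).Additive] in
lemma IsRetractDense.comp_map_center_comp [F.Full] (η : Center C) {Y Y' : D} {X X' : C}
    (r : Retract Y (F.obj X)) (r' : Retract Y' (F.obj X')) (g : Y ⟶ Y') :
    g ≫ r'.i ≫ F.map (η.1.app X') ≫ r'.r = (r.i ≫ F.map (η.1.app X) ≫ r.r) ≫ g := by
  obtain ⟨f, hf⟩ := F.map_surjective (r.r ≫ g ≫ r'.i)
  have h : F.map f ≫ F.map (η.1.app X') = F.map (η.1.app X) ≫ F.map f := by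
    rw [← F.map_comp, ← F.map_comp, CatCenter.naturality]
  have h₁ := r.i ≫= h =≫ r'.r
  rw [hf] at h₁
  simpa using h₁

lemma IsRetractDense.exists_centerCompatible [F.Full] [F.CommShift ℤ] (hF : IsRetractDense F)
    (η : Center C) : ∃ θ : Center D, CenterCompatible F η θ := by
  choose X r using hF
  have r := fun Y => (r Y).some
  let θ : CatCenter D :=
    { app := fun Y => (r Y).i ≫ F.map (η.1.app (X Y)) ≫ (r Y).r
      naturality := fun Y Y' g => IsRetractDense.comp_map_center_comp η (r Y) (r Y') g }
  -- Independence of the choice allows `θ` to be computed with whichever retraction suits: the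
  -- shifted one at `Y⟦1⟧`, the trivial one at `F.obj Z`.
  have hθ : ∀ {Y : D} {Z : C} (s : Retract Y (F.obj Z)),
      θ.app Y = s.i ≫ F.map (η.1.app Z) ≫ s.r := fun {Y Z} s => by
    have := IsRetractDense.comp_map_center_comp η s (r Y) (𝟙 Y)
    rwa [Category.id_comp, Category.comp_id] at this
  refine ⟨⟨θ, fun Y => ?_⟩, fun Z => ?_⟩
  · rw [hθ (((r Y).map (shiftFunctor D (1 : ℤ))).trans
      (Retract.ofIso ((F.commShiftIso (1 : ℤ)).app (X Y)).symm)), η.2]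
    have h := (F.commShiftIso (1 : ℤ)).hom.naturality (η.1.app (X Y))
    have h₁ : F.map ((η.1.app (X Y))⟦(1 : ℤ)⟧') ≫ (F.commShiftIso (1 : ℤ)).hom.app (X Y) =
      (F.commShiftIso (1 : ℤ)).hom.app (X Y) ≫ (F.map (η.1.app (X Y)))⟦(1 : ℤ)⟧' := h
    change ((r Y).i⟦(1 : ℤ)⟧' ≫ (F.commShiftIso (1 : ℤ)).inv.app (X Y)) ≫ _ ≫
      (F.commShiftIso (1 : ℤ)).hom.app (X Y) ≫ (r Y).r⟦(1 : ℤ)⟧' =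
        ((r Y).i ≫ F.map (η.1.app (X Y)) ≫ (r Y).r)⟦(1 : ℤ)⟧'
    rw [reassoc_of% h₁, Functor.map_comp, Functor.map_comp, Category.assoc]
    congr 1
    exact (F.commShiftIso (1 : ℤ)).inv_hom_id_app_assoc (X Y) _
  · change θ.app _ = _
    rw [hθ (Retract.refl _)]
    simp

/-- The homomorphism between centers induced by a functor `F : C ⥤ D`, if every object of `D` is a
retract of an object in the image of `F`, and every element of the center of `C` lifts. -/
def IsRetractDense.centerMap [F.Additive] (hF : IsRetractDense F)
    (h : ∀ η : Center C, ∃ θ : Center D, CenterCompatible F η θ) : Center C →+* Center D where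
  toFun η := (h η).choose
  map_one' := hF.center_eq (h 1).choose_spec .one
  map_mul' a b := hF.center_eq (h _).choose_spec ((h a).choose_spec.mul (h b).choose_spec)
  map_zero' := hF.center_eq (h 0).choose_spec .zero
  map_add' a b := hF.center_eq (h _).choose_spec ((h a).choose_spec.add (h b).choose_spec)

lemma IsRetractDense.centerMap_compatible [F.Additive] (hF : IsRetractDense F)
    (h : ∀ η : Center C, ∃ θ : Center D, CenterCompatible F η θ) (η : Center C) :
    CenterCompatible F η (hF.centerMap h η) :=
  (h η).choose_spec

end DenseCenter

/-! ### Centers of Verdier quotients -/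

section QuotientCenter

variable {T : Type u₁} [Category.{v₁} T] [Preadditive T] [HasZeroObject T] [HasShift T ℤ]
  [∀ n : ℤ, (shiftFunctor T n).Additive] [Pretriangulated T] [IsTriangulated T]
  {T' : Type u₂} [Category.{v₂} T'] [Preadditive T'] [HasZeroObject T'] [HasShift T' ℤ]
  [∀ n : ℤ, (shiftFunctor T' n).Additive] [Pretriangulated T'] [IsTriangulated T']
  {Φ : T ⥤ T'} [Φ.CommShift ℤ] [Φ.IsTriangulated]
  {A A₁ : ThickSubcategory T} {B B₁ : ThickSubcategory T'}

instance quotientMapLifting (h : ∀ X, A.carrier X → B.carrier (Φ.obj X)) :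
    Localization.Lifting (quotientFunctor A) A.carrier.trW (Φ ⋙ quotientFunctor B)
      (quotientMap Φ h) :=
  ⟨quotientMapFac Φ h⟩

instance quotientMapCommShift (h : ∀ X, A.carrier X → B.carrier (Φ.obj X)) :
    (quotientMap Φ h).CommShift ℤ :=
  Functor.commShiftOfLocalization (quotientFunctor A) A.carrier.trW ℤ (Φ ⋙ quotientFunctor B)
    (quotientMap Φ h)

variable (Φ) in
/-- Passing to a larger subcategory of `T` does not change the induced functor. -/
def quotientResCompQuotientMap (h : A ≤ A₁) (h₁ : ∀ X, A₁.carrier X → B.carrier (Φ.obj X)) :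
    quotientRes h ⋙ quotientMap Φ h₁ ≅ quotientMap Φ fun X hX => h₁ X (h X hX) :=
  have : Localization.Lifting (quotientFunctor A) A.carrier.trW (Φ ⋙ quotientFunctor B)
      (quotientRes h ⋙ quotientMap Φ h₁) :=
    ⟨(Functor.associator _ _ _).symm ≪≫ Functor.isoWhiskerRight (quotientResFac h) _ ≪≫
      quotientMapFac Φ h₁⟩
  Localization.liftNatIso (quotientFunctor A) A.carrier.trW (Φ ⋙ quotientFunctor B)
    (Φ ⋙ quotientFunctor B) _ _ (Iso.refl _)

variable (Φ) in
/-- Passing to a larger subcategory of `T'` commutes with the induced functor. -/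
def quotientMapCompQuotientRes (h : B ≤ B₁) (h₁ : ∀ X, A.carrier X → B.carrier (Φ.obj X)) :
    quotientMap Φ h₁ ⋙ quotientRes h ≅ quotientMap Φ fun X hX => h _ (h₁ X hX) :=
  have : Localization.Lifting (quotientFunctor A) A.carrier.trW (Φ ⋙ quotientFunctor B₁)
      (quotientMap Φ h₁ ⋙ quotientRes h) :=
    ⟨(Functor.associator _ _ _).symm ≪≫ Functor.isoWhiskerRight (quotientMapFac Φ h₁) _ ≪≫
      Functor.associator _ _ _ ≪≫ Functor.isoWhiskerLeft Φ (quotientResFac h)⟩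
  Localization.liftNatIso (quotientFunctor A) A.carrier.trW (Φ ⋙ quotientFunctor B₁)
    (Φ ⋙ quotientFunctor B₁) _ _ (Iso.refl _)

namespace IsSpectralEmbedding

variable (hΦ : IsSpectralEmbedding Φ)

include hΦ

omit [IsTriangulated T] [IsTriangulated T'] in
lemma isRetractDense_quotientMap (h : ∀ X, A.carrier X → B.carrier (Φ.obj X)) :
    IsRetractDense (quotientMap Φ h) := fun Y => by
  obtain ⟨X, ⟨r⟩⟩ := hΦ.exists_retract ((quotientFunctor B).objPreimage Y)
  exact ⟨(quotientFunctor A).obj X,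
    ⟨((Retract.ofIso ((quotientFunctor B).objObjPreimageIso Y).symm).trans
      (r.map (quotientFunctor B))).trans (Retract.ofIso ((quotientMapFac Φ h).app X).symm)⟩⟩

/-- Since `T/A ⥤ T'/B` need not be full, `η` is first moved to `T/Φ⁻¹B` by localization, and then
extended along the full functor `T/Φ⁻¹B ⥤ T'/B`. -/
lemma exists_centerCompatible (h : ∀ X, A.carrier X → B.carrier (Φ.obj X))
    (η : Center (VerdierQuotient A)) :
    ∃ θ : Center (VerdierQuotient B), CenterCompatible (quotientMap Φ h) η θ := by
  have := hΦ.full B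
  have h₁ : A ≤ B.comap Φ := h
  obtain ⟨θ, hθ⟩ := (hΦ.isRetractDense_quotientMap (B.carrier_of_comap Φ)).exists_centerCompatible (centerRes h₁ η)
  exact ⟨θ, ((centerRes_compatible h₁ η).comp hθ).of_iso (quotientResCompQuotientMap Φ h₁ _)⟩

/-- The homomorphism `Z(T/A) → Z(T'/B)` for `A ≤ Φ⁻¹ B`. -/
def centerMap (h : ∀ X, A.carrier X → B.carrier (Φ.obj X)) :
    Center (VerdierQuotient A) →+* Center (VerdierQuotient B) :=
  (hΦ.isRetractDense_quotientMap h).centerMap (hΦ.exists_centerCompatible h)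

lemma centerMap_compatible (h : ∀ X, A.carrier X → B.carrier (Φ.obj X))
    (η : Center (VerdierQuotient A)) :
    CenterCompatible (quotientMap Φ h) η (hΦ.centerMap h η) :=
  IsRetractDense.centerMap_compatible _ _ _

/-- Here the functor is fully faithful: faithfulness gives injectivity, and any `θ` restricts to a
central element of `T/A` that must map back to it by uniqueness. -/
lemma centerMap_bijective (h : ∀ X, A.carrier X ↔ B.carrier (Φ.obj X)) :
    Function.Bijective (hΦ.centerMap fun X => (h X).1) := by
  obtain rfl : A = B.comap Φ := ThickSubcategory.ext (funext fun X => propext (h X))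
  have := hΦ.full B
  have := hΦ.faithful B
  constructor
  · intro η η' hη
    apply Subtype.ext
    apply CatCenter.ext
    intro X
    apply (quotientMap Φ (B.carrier_of_comap Φ)).map_injective
    rw [← hΦ.centerMap_compatible (B.carrier_of_comap Φ) η,
      ← hΦ.centerMap_compatible (B.carrier_of_comap Φ) η']
    exact congrArg (fun θ : Center _ => θ.1.app _) hη
  · intro θ
    obtain ⟨η, hη⟩ := exists_centerCompatible_left
      (quotientMap Φ (B.carrier_of_comap Φ)) θ
    exact ⟨η, (hΦ.isRetractDense_quotientMap _).center_eq (hΦ.centerMap_compatible _ η) hη⟩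

lemma centerMap_mem_lnil (h : ∀ X, A.carrier X → B.carrier (Φ.obj X))
    {η : Center (VerdierQuotient A)} (hη : η ∈ lnil _) : hΦ.centerMap h η ∈ lnil _ :=
  (hΦ.centerMap_compatible h η).mem_lnil (hΦ.isRetractDense_quotientMap h) hη

lemma centerMap_mem_lnil_iff (h : ∀ X, A.carrier X ↔ B.carrier (Φ.obj X))
    (η : Center (VerdierQuotient A)) :
    hΦ.centerMap (fun X => (h X).1) η ∈ lnil _ ↔ η ∈ lnil _ := by
  refine ⟨fun hη => ?_, hΦ.centerMap_mem_lnil _⟩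
  obtain rfl : A = B.comap Φ := ThickSubcategory.ext (funext fun X => propext (h X))
  have := hΦ.faithful B
  exact (hΦ.centerMap_compatible _ η).mem_lnil_of_faithful hη

/-- Both sides are compatible with `η` along the same functor `T/A ⥤ T'/B₁`, and there is only one
such element. -/
lemma centerMap_centerRes (h : ∀ X, A.carrier X → B.carrier (Φ.obj X))
    (h₁ : ∀ X, A₁.carrier X → B₁.carrier (Φ.obj X)) (hA : A ≤ A₁) (hB : B ≤ B₁)
    (η : Center (VerdierQuotient A)) :
    hΦ.centerMap h₁ (centerRes hA η) = centerRes hB (hΦ.centerMap h η) :=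
  (hΦ.isRetractDense_quotientMap fun X hX => h₁ X (hA X hX)).center_eq
    (((centerRes_compatible hA η).comp (hΦ.centerMap_compatible h₁ _)).of_iso
      (quotientResCompQuotientMap Φ hA h₁))
    (((hΦ.centerMap_compatible h η).comp (centerRes_compatible hB _)).of_iso
      (quotientMapCompQuotientRes Φ hB h))

/-- The homomorphism `Z((T/A)^♮) → Z((T'/B)^♮)` for `A ≤ Φ⁻¹ B`. -/
def completedCenterMap (h : ∀ X, A.carrier X → B.carrier (Φ.obj X)) :
    Center (CompletedQuotient A) →+* Center (CompletedQuotient B) :=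
  (karoubiCenterEquiv.toRingHom.comp (hΦ.centerMap h)).comp karoubiCenterEquiv.symm.toRingHom

lemma completedCenterMap_compatible (h : ∀ X, A.carrier X → B.carrier (Φ.obj X))
    (η : Center (CompletedQuotient A)) :
    CenterCompatible (karoubiMap (quotientMap Φ h)) η (hΦ.completedCenterMap h η) := by
  have := karoubiCenterEquiv_compatible (hΦ.centerMap_compatible h (karoubiCenterEquiv.symm η))
  rwa [RingEquiv.apply_symm_apply] at this

lemma eq_completedCenterMap (h : ∀ X, A.carrier X → B.carrier (Φ.obj X))
    {η : Center (CompletedQuotient A)} {θ : Center (CompletedQuotient B)}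
    (hθ : CenterCompatible (karoubiMap (quotientMap Φ h)) η θ) :
    θ = hΦ.completedCenterMap h η :=
  (hΦ.isRetractDense_quotientMap h).karoubiMap.center_eq hθ (hΦ.completedCenterMap_compatible h η)

/-- The homomorphism `Z((T/A)^♮)_lred → Z((T'/B)^♮)_lred` for `A ≤ Φ⁻¹ B`. -/
def completedCenterLredMap (h : ∀ X, A.carrier X → B.carrier (Φ.obj X)) :
    CenterLred (CompletedQuotient A) →+* CenterLred (CompletedQuotient B) :=
  Ideal.quotientMap _ (hΦ.completedCenterMap h) (by
    intro η hη
    change karoubiCenterEquiv (hΦ.centerMap h (karoubiCenterEquiv.symm η)) ∈ lnil _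
    rw [karoubiCenterEquiv_lnil]
    refine hΦ.centerMap_mem_lnil h ?_
    rwa [← karoubiCenterEquiv_lnil, RingEquiv.apply_symm_apply])

lemma completedCenterLredMap_bijective (h : ∀ X, A.carrier X ↔ B.carrier (Φ.obj X)) :
    Function.Bijective (hΦ.completedCenterLredMap fun X => (h X).1) := by
  constructor
  · apply Ideal.quotientMap_injective'
    intro η hη
    change karoubiCenterEquiv (hΦ.centerMap _ (karoubiCenterEquiv.symm η)) ∈ lnil _ at hη
    rwa [karoubiCenterEquiv_lnil, hΦ.centerMap_mem_lnil_iff h, ← karoubiCenterEquiv_lnil,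
      RingEquiv.apply_symm_apply] at hη
  · apply Ideal.quotientMap_surjective
    exact (karoubiCenterEquiv.surjective.comp (hΦ.centerMap_bijective h).2).comp
      karoubiCenterEquiv.symm.surjective

lemma completedCenterLredMap_completedCenterLredRes
    (h : ∀ X, A.carrier X → B.carrier (Φ.obj X)) (h₁ : ∀ X, A₁.carrier X → B₁.carrier (Φ.obj X))
    (hA : A ≤ A₁) (hB : B ≤ B₁) (η : CenterLred (CompletedQuotient A)) :
    hΦ.completedCenterLredMap h₁ (completedCenterLredRes hA η) =
      completedCenterLredRes hB (hΦ.completedCenterLredMap h η) := by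
  obtain ⟨η, rfl⟩ := Ideal.Quotient.mk_surjective η
  change Ideal.Quotient.mk _ (karoubiCenterEquiv (hΦ.centerMap h₁ (karoubiCenterEquiv.symm
      (karoubiCenterEquiv (centerRes hA (karoubiCenterEquiv.symm η)))))) =
    Ideal.Quotient.mk _ (karoubiCenterEquiv (centerRes hB (karoubiCenterEquiv.symm
      (karoubiCenterEquiv (hΦ.centerMap h (karoubiCenterEquiv.symm η))))))
  rw [RingEquiv.symm_apply_apply, RingEquiv.symm_apply_apply, hΦ.centerMap_centerRes h h₁ hA hB]

end IsSpectralEmbedding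

end QuotientCenter

end TriangularSpectrum

end

noncomputable section

namespace TriangularSpectrum

open AlgebraicGeometry TopCat.Presheaf Topology

/-! ### Sheafifications of presheaves and morphisms of sheafed spaces -/

section Sheafification

/-- Precomposition with a left adjoint of a continuous functor preserves morphisms which become
isomorphisms after sheafification. -/
lemma whiskerLeft_mem_W {C : Type u₁} [Category.{v₁} C] {D : Type u₂} [Category.{v₂} D]
    {A : Type u₃} [Category.{v₃} A] {G : C ⥤ D} {H : D ⥤ C} (adj : G ⊣ H)
    (K : GrothendieckTopology C) (J : GrothendieckTopology D) [H.IsContinuous J K]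
    {P Q : Dᵒᵖ ⥤ A} (f : P ⟶ Q) (hf : J.W f) : K.W (Functor.whiskerLeft G.op f) := by
  intro Z hZ
  let adj' := adj.op.whiskerLeft A
  have h₁ := hf (H.op ⋙ Z) (Functor.op_comp_isSheaf H J K ⟨Z, hZ⟩)
  -- Under the adjunction, precomposition with the whiskered `f` into `Z` becomes precomposition
  -- with `f` into the sheaf `H.op ⋙ Z`.
  have h₂ : (fun g : G.op ⋙ Q ⟶ Z => Functor.whiskerLeft G.op f ≫ g) =
      (adj'.homEquiv P Z).symm ∘ (fun g => f ≫ g) ∘ adj'.homEquiv Q Z := by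
    funext g
    exact (Equiv.eq_symm_apply _).2 (adj'.homEquiv_naturality_left f g)
  rw [h₂]
  exact (adj'.homEquiv P Z).symm.bijective.comp (h₁.comp (adj'.homEquiv Q Z).bijective)

variable {X X' : TopCat.{u}} {A : Type u₁} [Category.{v₁} A] {b : X' ⟶ X}

/-- Let `c` be a morphism from a sheaf `G` on `X` to the direct image of a sheaf `G'` on `X'` under
an open embedding. If `G` and `G'` are sheafifications of presheaves `F` and `F'`, and `c` is
obtained from a morphism `φ : F ⟶ b_* F'` which is an isomorphism on the open subsets of `X'`, then
so is `c`. -/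
lemma isIso_app_of_sheafification {F G : X.Presheaf A} {F' G' : X'.Presheaf A}
    (i : F ⟶ G) (i' : F' ⟶ G') (hi : (Opens.grothendieckTopology X).W i)
    (hi' : (Opens.grothendieckTopology X').W i') (hG : G.IsSheaf) (hG' : G'.IsSheaf)
    (hb : IsOpenEmbedding b) (φ : F ⟶ (pushforward A b).obj F') (c : G ⟶ (pushforward A b).obj G')
    (fac : i ≫ c = φ ≫ (pushforward A b).map i')
    (hφ : ∀ U : Opens X', IsIso (φ.app (op (hb.functor.obj U)))) (U : Opens X') :
    IsIso (c.app (op (hb.functor.obj U))) := by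
  let J := Opens.grothendieckTopology X
  let J' := Opens.grothendieckTopology X'
  have h₁ : J'.W (Functor.whiskerLeft hb.functor.op i) :=
    whiskerLeft_mem_W hb.isOpenMap.adjunction J' J i hi
  -- The preimage of the image of an open set is that open set, so restricting the direct image of
  -- `i'` gives back `i'`.
  have h₂ : J'.W (Functor.whiskerLeft hb.functor.op ((pushforward A b).map i')) := by
    let ε : hb.functor.op ⋙ (Opens.map b).op ≅ 𝟭 (Opens X')ᵒᵖ :=
      NatIso.ofComponents (fun V => (eqToIso (Opens.ext
        (Set.preimage_image_eq V.unop.1 hb.injective))).op.symm) (fun _ => Subsingleton.elim _ _)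
    refine (J'.W.arrow_mk_iso_iff (Arrow.isoMk (Functor.isoWhiskerRight ε F')
      (Functor.isoWhiskerRight ε G') ?_)).2 hi'
    ext V
    exact i'.naturality (ε.hom.app V)
  have h₃ : IsIso (Functor.whiskerLeft hb.functor.op φ) := by
    have (V : (Opens X')ᵒᵖ) : IsIso ((Functor.whiskerLeft hb.functor.op φ).app V) := hφ V.unop
    exact NatIso.isIso_of_isIso_app _
  have h₄ : J'.W (Functor.whiskerLeft hb.functor.op c) := by
    refine J'.W.of_precomp (Functor.whiskerLeft hb.functor.op i) _ h₁ ?_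
    rw [← Functor.whiskerLeft_comp, fac, Functor.whiskerLeft_comp]
    exact (J'.W.cancel_left_of_respectsIso _ _).2 h₂
  -- A morphism between sheaves that sheafification inverts is already an isomorphism.
  have h₅ : IsIso (Functor.whiskerLeft hb.functor.op c) :=
    (ObjectProperty.isLocal_iff_isIso _ _ (isSheaf_of_isOpenEmbedding hb hG)
      (isSheaf_of_isOpenEmbedding hb (TopCat.Sheaf.pushforward_sheaf_of_sheaf b hG'))).1 h₄
  exact inferInstanceAs (IsIso ((Functor.whiskerLeft hb.functor.op c).app (op U)))

variable (F : X.Presheaf A) (F' : X'.Presheaf A)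
  [HasSheafify (Opens.grothendieckTopology X) A] [HasSheafify (Opens.grothendieckTopology X') A]

/-- The sheafed space given by the sheafification of a presheaf. -/
def sheafifiedSpace : SheafedSpace A where
  carrier := X
  presheaf := sheafify (Opens.grothendieckTopology X) F
  IsSheaf := ((presheafToSheaf _ _).obj F).2

variable {F F'}

/-- The morphism of sheafed spaces induced by a morphism of presheaves. -/
def sheafifiedSpaceMap (b : X' ⟶ X) (φ : F ⟶ (pushforward A b).obj F') :
    sheafifiedSpace F' ⟶ sheafifiedSpace F where
  hom :=
    { base := b
      c := sheafifyLift (Opens.grothendieckTopology X)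
        (φ ≫ (pushforward A b).map (toSheafify (Opens.grothendieckTopology X') F'))
        (TopCat.Sheaf.pushforward_sheaf_of_sheaf b (sheafifiedSpace F').IsSheaf) }

lemma toSheafify_sheafifiedSpaceMap (b : X' ⟶ X) (φ : F ⟶ (pushforward A b).obj F') :
    toSheafify (Opens.grothendieckTopology X) F ≫ (sheafifiedSpaceMap b φ).hom.c =
      φ ≫ (pushforward A b).map (toSheafify (Opens.grothendieckTopology X') F') :=
  toSheafify_sheafifyLift _ _ _

/-- By the universal property of sheafification, the map on sheaves is determined by its composite
with `toSheafify`. -/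
lemma eq_sheafifiedSpaceMap (f : sheafifiedSpace F' ⟶ sheafifiedSpace F)
    (φ : F ⟶ (pushforward A f.hom.base).obj F')
    (h : ∀ V : Opens X, (toSheafify (Opens.grothendieckTopology X) F).app (op V) ≫
      f.hom.c.app (op V) = φ.app (op V) ≫ (toSheafify (Opens.grothendieckTopology X') F').app
        (op ((Opens.map f.hom.base).obj V))) :
    f = sheafifiedSpaceMap (X := X) (X' := X') f.hom.base φ := by
  let c : sheafify (Opens.grothendieckTopology X) F ⟶
      (pushforward A f.hom.base).obj (sheafify (Opens.grothendieckTopology X') F') := f.hom.c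
  have h₁ : f.hom.c = (sheafifiedSpaceMap (X := X) (X' := X') f.hom.base φ).hom.c :=
    sheafifyLift_unique (Opens.grothendieckTopology X)
      (φ ≫ (pushforward A f.hom.base).map (toSheafify (Opens.grothendieckTopology X') F'))
      (TopCat.Sheaf.pushforward_sheaf_of_sheaf f.hom.base (sheafifiedSpace F').IsSheaf) c
      (NatTrans.ext (funext fun V => h V.unop))
  exact congrArg (fun c => (⟨⟨f.hom.base, c⟩⟩ : sheafifiedSpace F' ⟶ sheafifiedSpace F)) h₁

lemma isOpenImmersion_sheafifiedSpaceMap (b : X' ⟶ X) (φ : F ⟶ (pushforward A b).obj F')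
    (hb : IsOpenEmbedding b) (hφ : ∀ U : Opens X', IsIso (φ.app (op (hb.functor.obj U)))) :
    SheafedSpace.IsOpenImmersion (sheafifiedSpaceMap b φ) where
  base_open := hb
  c_iso U := isIso_app_of_sheafification _ _ (GrothendieckTopology.W_toSheafify _ F)
    (GrothendieckTopology.W_toSheafify _ F') (sheafifiedSpace F).IsSheaf
    (sheafifiedSpace F').IsSheaf hb φ _ (toSheafify_sheafifiedSpaceMap b φ) hφ U

end Sheafification

end TriangularSpectrum

end

noncomputable section

namespace TriangularSpectrum

open AlgebraicGeometry TopCat.Presheaf Topology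

universe w

/-! ### The map on triangular spectra -/

/-- Every prime in `V` is the preimage of a prime in the inverse image of `V`, so the two
intersections correspond. -/
lemma kernelOn_iff {T : Type u₁} [Category.{v₁} T] [Preadditive T] [HasZeroObject T]
    [HasShift T ℤ] [∀ n : ℤ, (shiftFunctor T n).Additive] [Pretriangulated T]
    {T' : Type u₂} [Category.{v₂} T'] [Preadditive T'] [HasZeroObject T'] [HasShift T' ℤ]
    [∀ n : ℤ, (shiftFunctor T' n).Additive] [Pretriangulated T'] {Φ : T ⥤ T'}
    {b : C(Spectrum T', Spectrum T)}
    (hb : ∀ P : Spectrum T', (b P).1.carrier = P.1.carrier.inverseImage Φ)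
    (V : Opens (Spectrum T)) (hV : (V : Set (Spectrum T)) ⊆ Set.range b) (X : T) :
    (kernelOn V).carrier X ↔ (kernelOn (V.comap b)).carrier (Φ.obj X) := by
  refine ⟨kernelOn_map Φ b hb V X, fun hX K ⟨P, hP, hK⟩ => ?_⟩
  subst hK
  obtain ⟨P, rfl⟩ := hV hP
  rw [hb]
  exact hX _ ⟨P, hP, rfl⟩

section Spectrum

variable {T : Type u₁} [Category.{v₁} T] [Preadditive T] [HasZeroObject T] [HasShift T ℤ]
  [∀ n : ℤ, (shiftFunctor T n).Additive] [Pretriangulated T]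
  {T' : Type u₂} [Category.{v₂} T'] [Preadditive T'] [HasZeroObject T'] [HasShift T' ℤ]
  [∀ n : ℤ, (shiftFunctor T' n).Additive] [Pretriangulated T']

lemma ThickSubcategory.isClosed_iff (S : Set (ThickSubcategory T)) :
    IsClosed S ↔ ∃ ℰ : Set T, zeroLocus ℰ = S := by
  rw [← isOpen_compl_iff]
  change Sᶜᶜ ∈ Set.range zeroLocus ↔ _
  rw [compl_compl]
  rfl

lemma ThickSubcategory.generatedBy_le_iff (M : T) (K : ThickSubcategory T) :
    generatedBy M ≤ K ↔ K.carrier M :=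
  ⟨fun h => h M fun _ hL => hL, fun h _ hX => hX K h⟩

lemma isOpen_setOf_carrier (M : T) : IsOpen {P : Spectrum T | P.1.carrier M} := by
  have h : IsClosed (ThickSubcategory.zeroLocus {M}) :=
    (ThickSubcategory.isClosed_iff _).2 ⟨_, rfl⟩
  convert (h.preimage continuous_subtype_val).isOpen_compl using 1
  ext P
  simp [ThickSubcategory.zeroLocus]

variable {Φ : T ⥤ T'} [Φ.CommShift ℤ] [Φ.IsTriangulated]

namespace IsSpectralEmbedding

variable (hΦ : IsSpectralEmbedding Φ)

include hΦ

/-- Membership of any `M'` in a thick subcategory is detected on an object `Φ M` that works for all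
thick subcategories at once. -/
lemma comap_le_comap_iff {L L' : ThickSubcategory T'} : L.comap Φ ≤ L'.comap Φ ↔ L ≤ L' := by
  refine ⟨fun h M' hM' => ?_, fun h X hX => h _ hX⟩
  obtain ⟨M, hM⟩ := hΦ.exists_carrier_iff M'
  exact (hM L').2 (h M ((hM L).1 hM'))

lemma comap_lt_comap_iff {L L' : ThickSubcategory T'} : L.comap Φ < L'.comap Φ ↔ L < L' := by
  rw [lt_iff_le_not_ge, lt_iff_le_not_ge, hΦ.comap_le_comap_iff, hΦ.comap_le_comap_iff]

lemma comap_injective : Function.Injective (ThickSubcategory.comap Φ) := fun _ _ h =>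
  le_antisymm (hΦ.comap_le_comap_iff.1 h.le) (hΦ.comap_le_comap_iff.1 h.ge)

lemma comap_carrier_eq_top_iff (L : ThickSubcategory T') :
    (L.comap Φ).carrier = ⊤ ↔ L.carrier = ⊤ := by
  constructor
  · intro h
    refine top_le_iff.1 fun M' _ => ?_
    obtain ⟨M, hM⟩ := hΦ.exists_carrier_iff M'
    exact (hM L).2 (top_le_iff.2 h M trivial)
  · intro h
    exact top_le_iff.1 fun M _ => top_le_iff.2 h (Φ.obj M) trivial

/-- Everything above `Φ⁻¹ P` is itself a preimage, so the order embedding matches the thick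
subcategories strictly above `P` with those strictly above `Φ⁻¹ P`, smallest elements included. -/
lemma isPrime_comap_iff (P : ThickSubcategory T') : (P.comap Φ).IsPrime ↔ P.IsPrime := by
  constructor
  · rintro ⟨h, X, hX, hX'⟩
    refine ⟨fun h' => h ((hΦ.comap_carrier_eq_top_iff P).2 h'), ?_⟩
    obtain ⟨X, rfl⟩ := hΦ.exists_comap_eq P X hX.le
    exact ⟨X, hΦ.comap_lt_comap_iff.1 hX, fun Y hY =>
      hΦ.comap_le_comap_iff.1 (hX' (hΦ.comap_lt_comap_iff.2 hY))⟩
  · rintro ⟨h, X, hX, hX'⟩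
    refine ⟨fun h' => h ((hΦ.comap_carrier_eq_top_iff P).1 h'), X.comap Φ,
      hΦ.comap_lt_comap_iff.2 hX, fun Y hY => ?_⟩
    obtain ⟨Y, rfl⟩ := hΦ.exists_comap_eq P Y (le_of_lt hY)
    exact hΦ.comap_le_comap_iff.2 (hX' (hΦ.comap_lt_comap_iff.1 hY))

/-- Zero loci correspond both ways: replace each `M'` by the chosen object of `T` in one direction,
and apply `Φ` in the other. -/
lemma isInducing_comap : IsInducing (ThickSubcategory.comap Φ) := by
  choose m hm using hΦ.exists_carrier_iff
  refine ⟨TopologicalSpace.ext_isClosed fun S => ?_⟩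
  rw [ThickSubcategory.isClosed_iff, isClosed_induced_iff]
  constructor
  · rintro ⟨ℰ, rfl⟩
    refine ⟨_, (ThickSubcategory.isClosed_iff _).2 ⟨m '' ℰ, rfl⟩, ?_⟩
    ext L
    change (∀ X ∈ m '' ℰ, ¬ L.carrier (Φ.obj X)) ↔ ∀ X ∈ ℰ, ¬ L.carrier X
    rw [Set.forall_mem_image]
    exact forall₂_congr fun X _ => not_congr (hm X L).symm
  · rintro ⟨S, hS, rfl⟩
    obtain ⟨ℰ, rfl⟩ := (ThickSubcategory.isClosed_iff _).1 hS
    refine ⟨Φ.obj '' ℰ, ?_⟩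
    ext L
    change (∀ X ∈ Φ.obj '' ℰ, ¬ L.carrier X) ↔ ∀ X ∈ ℰ, ¬ L.carrier (Φ.obj X)
    rw [Set.forall_mem_image]

/-- Inverse images define a continuous map of triangular spectra. -/
lemma exists_continuousMap :
    ∃ b : C(Spectrum T', Spectrum T), ∀ P, (b P).1.carrier = P.1.carrier.inverseImage Φ :=
  ⟨⟨fun P => ⟨P.1.comap Φ, (hΦ.isPrime_comap_iff P.1).2 P.2⟩,
    (hΦ.isInducing_comap.continuous.comp continuous_subtype_val).subtype_mk _⟩, fun _ => rfl⟩

variable {b : C(Spectrum T', Spectrum T)}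
  (hb : ∀ P : Spectrum T', (b P).1.carrier = P.1.carrier.inverseImage Φ)

include hb

lemma isEmbedding : IsEmbedding b := by
  have h : Subtype.val ∘ b = ThickSubcategory.comap Φ ∘ Subtype.val :=
    funext fun P => ThickSubcategory.ext (hb P)
  constructor
  · have h₁ : IsInducing (Subtype.val ∘ b) :=
      h ▸ hΦ.isInducing_comap.comp IsInducing.subtypeVal
    exact (IsInducing.of_comp_iff IsInducing.subtypeVal).1 h₁
  · exact (h ▸ hΦ.comap_injective.comp Subtype.val_injective).of_comp

lemma mem_range_iff (P : Spectrum T) :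
    P ∈ Set.range b ↔ ∃ L : ThickSubcategory T', L.comap Φ = P.1 := by
  constructor
  · rintro ⟨P, rfl⟩
    exact ⟨P.1, ThickSubcategory.ext (hb P).symm⟩
  · rintro ⟨L, hL⟩
    obtain ⟨P, hP⟩ := P
    obtain rfl : L.comap Φ = P := hL
    exact ⟨⟨L, (hΦ.isPrime_comap_iff L).1 hP⟩, Subtype.ext (ThickSubcategory.ext (hb _))⟩

end IsSpectralEmbedding

end Spectrum

/-! ### The induced morphism of ringed spaces -/

section Morphism

-- These universes cover both applications: morphisms of `T/K` live in the larger universe `max u v`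
-- (take `w = u`), those of a dense extension in the same one (take `w = 0`). Both structure sheaves
-- then have values in the same category of rings.
variable {T : Type (max u w)} [Category.{v} T] [Preadditive T] [HasZeroObject T] [HasShift T ℤ]
  [∀ n : ℤ, (shiftFunctor T n).Additive] [Pretriangulated T] [IsTriangulated T]
  {T' : Type (max u w)} [Category.{max v w} T'] [Preadditive T'] [HasZeroObject T']
  [HasShift T' ℤ] [∀ n : ℤ, (shiftFunctor T' n).Additive] [Pretriangulated T'] [IsTriangulated T']
  {Φ : T ⥤ T'} [Φ.CommShift ℤ] [Φ.IsTriangulated]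

namespace IsSpectralEmbedding

variable (hΦ : IsSpectralEmbedding Φ)

include hΦ

/-- The morphism of presheaves given by `Z(T(V))_lred → Z(T'(b⁻¹ V))_lred`. -/
def presheafMap (b : C(Spectrum T', Spectrum T))
    (hb : ∀ P : Spectrum T', (b P).1.carrier = P.1.carrier.inverseImage Φ) :
    structurePresheaf T ⟶ (pushforward _ (TopCat.ofHom b)).obj (structurePresheaf T') where
  app V := CommRingCat.ofHom (hΦ.completedCenterLredMap (kernelOn_map Φ b hb V.unop))
  naturality V W f := by
    ext η
    exact hΦ.completedCenterLredMap_completedCenterLredRes _ _ _ _ η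

lemma isInducedBy_sheafifiedSpaceMap (b : C(Spectrum T', Spectrum T))
    (hb : ∀ P : Spectrum T', (b P).1.carrier = P.1.carrier.inverseImage Φ) :
    IsInducedBy Φ b (fun V => ((sheafifiedSpaceMap (TopCat.ofHom b)
      (hΦ.presheafMap b hb)).hom.c.app (op V)).hom) where
  base := hb
  sections V η := by
    refine ⟨hΦ.completedCenterMap (kernelOn_map Φ b hb V) η,
      hΦ.completedCenterMap_compatible _ η, ?_⟩
    have h := congrArg (fun α => (α.app (op V)).hom (Ideal.Quotient.mk _ η))
      (toSheafify_sheafifiedSpaceMap (TopCat.ofHom b) (hΦ.presheafMap b hb))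
    exact h

/-- The condition only asserts that some compatible `θ` exists, but `eq_completedCenterMap` leaves a
single candidate. So the map is prescribed on all sections coming from the presheaf, hence
everywhere. -/
lemma eq_sheafifiedSpaceMap (f : triangularSpectrum T' ⟶ triangularSpectrum T)
    (hf : IsInducedBy Φ f.hom.base.hom (fun V => (f.hom.c.app (op V)).hom)) :
    f = sheafifiedSpaceMap (F := structurePresheaf T) (F' := structurePresheaf T')
      (TopCat.ofHom f.hom.base.hom) (hΦ.presheafMap f.hom.base.hom hf.base) := by
  refine TriangularSpectrum.eq_sheafifiedSpaceMap (F := structurePresheaf T)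
    (F' := structurePresheaf T') f (hΦ.presheafMap f.hom.base.hom hf.base)
    fun V => ?_
  refine CommRingCat.hom_ext (RingHom.ext fun η => ?_)
  obtain ⟨η, rfl⟩ := Ideal.Quotient.mk_surjective η
  obtain ⟨θ, hθ, h⟩ := hf.sections V η
  refine h.trans ?_
  rw [hΦ.eq_completedCenterMap _ hθ]
  rfl

theorem existsUnique_isInducedBy :
    ∃! f : triangularSpectrum T' ⟶ triangularSpectrum T,
      IsInducedBy Φ f.hom.base.hom (fun V => (f.hom.c.app (op V)).hom) := by
  obtain ⟨b, hb⟩ := hΦ.exists_continuousMap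
  refine ⟨sheafifiedSpaceMap (TopCat.ofHom b) (hΦ.presheafMap b hb),
    hΦ.isInducedBy_sheafifiedSpaceMap b hb, fun f hf => ?_⟩
  have h : f.hom.base.hom = b := by
    ext1 P
    exact Subtype.ext (ThickSubcategory.ext ((hf.base P).trans (hb P).symm))
  rw [hΦ.eq_sheafifiedSpaceMap f hf]
  subst h
  rfl

theorem isOpenImmersion (f : triangularSpectrum T' ⟶ triangularSpectrum T)
    (hf : IsInducedBy Φ f.hom.base.hom (fun V => (f.hom.c.app (op V)).hom))
    (hopen : IsOpen (Set.range f.hom.base)) : SheafedSpace.IsOpenImmersion f := by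
  have hb : IsOpenEmbedding f.hom.base := ⟨hΦ.isEmbedding hf.base, hopen⟩
  rw [hΦ.eq_sheafifiedSpaceMap f hf]
  refine isOpenImmersion_sheafifiedSpaceMap _ _ hb fun U => ?_
  -- The image of `U` lies in the range of the base map, so `kernelOn_iff` provides the exact
  -- preimage condition needed for bijectivity.
  exact (RingEquiv.ofBijective _ (hΦ.completedCenterLredMap_bijective
    (kernelOn_iff hf.base _ (Set.image_subset_range _ _)))).toCommRingCatIso.isIso_hom

end IsSpectralEmbedding

end Morphism

end TriangularSpectrum

end

theorem mainTheorem11 {T : Type u} [Category.{v} T] [Preadditive T] [HasZeroObject T]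
    [HasShift T ℤ] [∀ n : ℤ, (shiftFunctor T n).Additive] [Pretriangulated T] [IsTriangulated T] :
    -- the quotient functor induces a (unique) morphism of ringed spaces
    (∀ K : ThickSubcategory T,
      ∃! f : triangularSpectrum (VerdierQuotient K) ⟶ triangularSpectrum T,
        IsInducedBy (quotientFunctor K) f.hom.base.hom (fun V => (f.hom.c.app (op V)).hom)) ∧
    -- this morphism is an open immersion of ringed spaces if its image is open
    (∀ (K : ThickSubcategory T)
      (f : triangularSpectrum (VerdierQuotient K) ⟶ triangularSpectrum T),
        IsInducedBy (quotientFunctor K) f.hom.base.hom (fun V => (f.hom.c.app (op V)).hom) →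
        IsOpen (Set.range f.hom.base) → AlgebraicGeometry.SheafedSpace.IsOpenImmersion f) ∧
    -- this is the case if the thick subcategory is generated by one object
    (∀ (M : T) (f : triangularSpectrum (VerdierQuotient (ThickSubcategory.generatedBy M)) ⟶
        triangularSpectrum T),
        IsInducedBy (quotientFunctor (ThickSubcategory.generatedBy M)) f.hom.base.hom
          (fun V => (f.hom.c.app (op V)).hom) →
        IsOpen (Set.range f.hom.base) ∧ AlgebraicGeometry.SheafedSpace.IsOpenImmersion f) ∧
    -- a fully faithful dense exact functor induces an isomorphism of ringed spaces
    (∀ (T' : Type u) [Category.{v} T'] [Preadditive T'] [HasZeroObject T'] [HasShift T' ℤ]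
      [∀ n : ℤ, (shiftFunctor T' n).Additive] [Pretriangulated T'] [IsTriangulated T']
      (Φ : T ⥤ T') [Φ.CommShift ℤ] [Φ.IsTriangulated] [Φ.Full] [Φ.Faithful],
      IsDenseFunctor Φ →
        (∃! f : triangularSpectrum T' ⟶ triangularSpectrum T,
          IsInducedBy Φ f.hom.base.hom (fun V => (f.hom.c.app (op V)).hom)) ∧
        (∀ f : triangularSpectrum T' ⟶ triangularSpectrum T,
          IsInducedBy Φ f.hom.base.hom (fun V => (f.hom.c.app (op V)).hom) → IsIso f)) := by
  refine ⟨fun K => ?_, fun K f hf hopen => ?_, fun M f hf => ?_, ?_⟩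
  · exact (isSpectralEmbedding_quotientFunctor K).existsUnique_isInducedBy.{v, u, u}
  · exact (isSpectralEmbedding_quotientFunctor K).isOpenImmersion.{v, u, u} f hf hopen
  · have hΦ := isSpectralEmbedding_quotientFunctor (ThickSubcategory.generatedBy M)
    -- A thick subcategory is a preimage from `T/⟨M⟩` exactly when it contains `⟨M⟩`, that is, when
    -- it contains `M`.
    have h : Set.range f.hom.base = {P : Spectrum T | P.1.carrier M} := Set.ext fun P =>
      (hΦ.mem_range_iff hf.base P).trans (Iff.trans
        ⟨fun ⟨L, hL⟩ => hL ▸ le_comap_quotientFunctor _ L, exists_comap_quotientFunctor_eq⟩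
        (ThickSubcategory.generatedBy_le_iff M P.1))
    have hopen : IsOpen (Set.range f.hom.base) := (congrArg _ h).mpr (isOpen_setOf_carrier M)
    exact ⟨hopen, hΦ.isOpenImmersion.{v, u, u} f hf hopen⟩
  · intro T' _ _ _ _ _ _ _ Φ _ _ _ _ hdense
    have hΦ := hdense.isSpectralEmbedding Φ
    refine ⟨hΦ.existsUnique_isInducedBy.{v, u, 0}, fun f hf => ?_⟩
    have hsurj : Function.Surjective f.hom.base := fun P =>
      (hΦ.mem_range_iff hf.base P).2 (IsDenseFunctor.exists_comap_eq Φ P.1)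
    have := hΦ.isOpenImmersion.{v, u, 0} f hf (hsurj.range_eq ▸ isOpen_univ)
    have : Epi f.hom.base := (TopCat.epi_iff_surjective _).2 hsurj
    exact AlgebraicGeometry.SheafedSpace.IsOpenImmersion.to_iso f
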